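/- Let $(\overline M^{n+1},\overline g)$ be a semi-Riemannian manifold of constant sectional curvature $c$ (i.e. every nondegenerate tangent plane has sectional curvature $c$), with Levi-Civita connection $\overline\nabla$, and let $\overline V$ be a smooth conformal vector field on $\overline M$ with smooth conformal factor $\sigma$, i.e. $\mathcal L_{\overline V}\,\overline g = 2\sigma\,\overline g$. Let $(M^n,g)$ be a Riemannian manifold (or, more generally, a semi-Riemannian one) with Levi-Civita connection $\nabla$, isometrically immersed in $\overline M$ as a hypersurface with a smooth unit normal vector field $N$, $\epsilon_N := \overline g(N,N) = \pm 1$. Let $\mathcal A$ be the Weingarten operator, $\mathcal A X = -(\overline\nabla_X N)^{\top}$ (so that $\overline\nabla_X N=-\mathcal A X$), let $V$ be the tangential part of $\overline V$ along $M$, and let $C := \overline g(\overline V, N)$ be the angle function on $M$. Then for all smooth vector fields $X, Y$ on $M$ the Hessian $\mathrm{Hess}\,C(X,Y) = g(\nabla_X \nabla C, Y)$ is given by $$\mathrm{Hess}\,C(X,Y) = -(cC + N\sigma)\,g(X,Y) + \sigma\, g(\mathcal A X,Y) + \epsilon_N C\, g(\mathcal A^2X,Y) - g((\nabla_V\mathcal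 A)X,Y) - g(\mathcal A\nabla_X V, Y) - g(\mathcal A\nabla_Y V, X),$$ where $N\sigma$ is the derivative of $\sigma$ in the direction $N$, $\sigma$ and $N\sigma$ are evaluated along the immersion, and $(\nabla_V\mathcal A)X=\nabla_V(\mathcal A X)-\mathcal A(\nabla_V X)$. -/

import Mathlib

open Bundle Manifold
open scoped ContDiff Topology

noncomputable section

namespace SemiRiem

variable {E : Type*} [NormedAddCommGroup E] [NormedSpace ℝ E]
  {H : Type*} [TopologicalSpace H] {I : ModelWithCorners ℝ E H}
  {M : Type*} [TopologicalSpace M] [ChartedSpace H M]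
  {E' : Type*} [NormedAddCommGroup E'] [NormedSpace ℝ E']
  {H' : Type*} [TopologicalSpace H'] {I' : ModelWithCorners ℝ E' H'}
  {M' : Type*} [TopologicalSpace M'] [ChartedSpace H' M']
  [IsManifold I ∞ M] [IsManifold I' ∞ M']

/-- The vector field `X` is smooth at the point `p`. -/
def SmoothFieldAt (X : ∀ p : M, TangentSpace I p) (p : M) : Prop :=
  ContMDiffAt I I.tangent ∞ (fun q => (⟨q, X q⟩ : TangentBundle I M)) p

/-- The vector field `X` is smooth on the whole manifold. -/
def SmoothField (X : ∀ p : M, TangentSpace I p) : Prop :=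
  ContMDiff I I.tangent ∞ (fun q => (⟨q, X q⟩ : TangentBundle I M))

/-- The vector field `X` is differentiable at the point `p`. -/
def DiffFieldAt (X : ∀ p : M, TangentSpace I p) (p : M) : Prop :=
  MDifferentiableAt I I.tangent (fun q => (⟨q, X q⟩ : TangentBundle I M)) p

/-- The vector field `W` along the map `f` is smooth. -/
def SmoothAlong (I : ModelWithCorners ℝ E H) (f : M → M')
    (W : ∀ p : M, TangentSpace I' (f p)) : Prop :=
  ContMDiff I I'.tangent ∞ (fun q => (⟨f q, W q⟩ : TangentBundle I' M'))

/-! ### Semi-Riemannian metrics -/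

variable (I M) in
/-- A semi-Riemannian metric: a smooth field of symmetric nondegenerate bilinear forms on the
tangent spaces. -/
structure Metric where
  /-- The scalar product on each tangent space. -/
  inner (p : M) : TangentSpace I p →L[ℝ] TangentSpace I p →L[ℝ] ℝ
  symm (p : M) (v w : TangentSpace I p) : inner p v w = inner p w v
  nondegenerate (p : M) (v : TangentSpace I p) (hv : ∀ w, inner p v w = 0) : v = 0
  contMDiff : ContMDiff I (I.prod 𝓘(ℝ, E →L[ℝ] E →L[ℝ] ℝ)) ∞
    (fun p => TotalSpace.mk' (E →L[ℝ] E →L[ℝ] ℝ)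
      (E := fun p : M => TangentSpace I p →L[ℝ] TangentSpace I p →L[ℝ] ℝ) p (inner p))

namespace Metric

/-- The metric at `p` as a bilinear form. -/
def bilin (g : Metric I M) (p : M) : LinearMap.BilinForm ℝ (TangentSpace I p) :=
  LinearMap.mk₂ ℝ (fun v w => g.inner p v w) (by simp) (by simp) (by simp) (by simp)

theorem bilin_nondegenerate (g : Metric I M) (p : M) : (g.bilin p).Nondegenerate := by
  refine ⟨fun v hv => g.nondegenerate p v hv, fun v hv => g.nondegenerate p v fun w => ?_⟩
  rw [g.symm]
  exact hv w

/-- The vector at `p` that represents the covector `ℓ` through the metric. -/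
def sharp [FiniteDimensional ℝ E] (g : Metric I M) (p : M) (ℓ : TangentSpace I p →L[ℝ] ℝ) :
    TangentSpace I p :=
  haveI : FiniteDimensional ℝ (TangentSpace I p) := inferInstanceAs (FiniteDimensional ℝ E)
  ((g.bilin p).toDual (g.bilin_nondegenerate p)).symm ℓ.toLinearMap

theorem inner_sharp [FiniteDimensional ℝ E] (g : Metric I M) (p : M)
    (ℓ : TangentSpace I p →L[ℝ] ℝ) (w : TangentSpace I p) :
    g.inner p (g.sharp p ℓ) w = ℓ w := by
  have : FiniteDimensional ℝ (TangentSpace I p) := inferInstanceAs (FiniteDimensional ℝ E)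
  exact LinearMap.BilinForm.apply_toDual_symm_apply (hB := g.bilin_nondegenerate p)
    ℓ.toLinearMap w

end Metric

/-! ### Levi-Civita connection, curvature, Hessian, conformal fields

In Mathlib's convention, `cov Y p v` is the covariant derivative `(∇_v Y)(p)`. -/

variable (I M) in
/-- Connections on the tangent bundle. -/
abbrev Connection :=
  CovariantDerivative I E (TangentSpace I : M → Type _)

/-- `cov` is the Levi-Civita connection of `g`: the (unique) connection on the tangent bundle
which is smooth, torsion free, and compatible with `g`. -/
structure IsLeviCivita (g : Metric I M) (cov : Connection I M) : Prop where
  smooth : ∀ U : Set M, IsOpen U → ContMDiffCovariantDerivativeOn E ∞ cov.toFun U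
  torsion_free : ∀ (X Y : ∀ p : M, TangentSpace I p) (p : M),
    DiffFieldAt X p → DiffFieldAt Y p →
      cov Y p (X p) - cov X p (Y p) = VectorField.mlieBracket I X Y p
  compatible : ∀ (Y Z : ∀ p : M, TangentSpace I p) (p : M) (v : TangentSpace I p),
    DiffFieldAt Y p → DiffFieldAt Z p →
      mvfderiv I (fun q => g.inner q (Y q) (Z q)) p v
        = g.inner p (cov Y p v) (Z p) + g.inner p (Y p) (cov Z p v)

/-- The curvature `R(X,Y)Z = ∇_X ∇_Y Z - ∇_Y ∇_X Z - ∇_[X,Y] Z`. -/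
def curvature (cov : Connection I M) (X Y Z : ∀ p : M, TangentSpace I p) (p : M) :
    TangentSpace I p :=
  cov (fun q => cov Z q (Y q)) p (X p) - cov (fun q => cov Z q (X q)) p (Y p)
    - cov Z p (VectorField.mlieBracket I X Y p)

/-- The Gram determinant of `v, w`; the vectors span a nondegenerate plane iff it is nonzero. -/
def gram (g : Metric I M) (p : M) (v w : TangentSpace I p) : ℝ :=
  g.inner p v v * g.inner p w w - g.inner p v w ^ 2

/-- The sectional curvature at `p` of the plane spanned by `X p` and `Y p`. -/
def sectionalCurvature (g : Metric I M) (cov : Connection I M)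
    (X Y : ∀ p : M, TangentSpace I p) (p : M) : ℝ :=
  g.inner p (curvature cov X Y Y p) (X p) / gram g p (X p) (Y p)

/-- All nondegenerate tangent planes have sectional curvature `c`. -/
def HasConstantSectionalCurvature (g : Metric I M) (cov : Connection I M) (c : ℝ) : Prop :=
  ∀ (X Y : ∀ p : M, TangentSpace I p) (p : M), SmoothFieldAt X p → SmoothFieldAt Y p →
    gram g p (X p) (Y p) ≠ 0 → sectionalCurvature g cov X Y p = c

/-- The Lie derivative of the metric: `(L_V g)(X,Y) = V(g(X,Y)) - g([V,X],Y) - g(X,[V,Y])`. -/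
def lieDerivMetric (g : Metric I M) (V X Y : ∀ p : M, TangentSpace I p) (p : M) : ℝ :=
  mvfderiv I (fun q => g.inner q (X q) (Y q)) p (V p)
    - g.inner p (VectorField.mlieBracket I V X p) (Y p)
    - g.inner p (X p) (VectorField.mlieBracket I V Y p)

/-- `V` is a (smooth) conformal vector field with (smooth) conformal factor `σ`:
`L_V g = 2 σ g`. -/
structure IsConformalField (g : Metric I M) (V : ∀ p : M, TangentSpace I p) (σ : M → ℝ) :
    Prop where
  smooth : SmoothField V
  smooth_factor : ContMDiff I 𝓘(ℝ, ℝ) ∞ σ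
  lieDeriv_eq : ∀ (X Y : ∀ p : M, TangentSpace I p) (p : M),
    SmoothFieldAt X p → SmoothFieldAt Y p →
      lieDerivMetric g V X Y p = 2 * σ p * g.inner p (X p) (Y p)

/-- The gradient of a function. -/
def grad [FiniteDimensional ℝ E] (g : Metric I M) (φ : M → ℝ) (p : M) : TangentSpace I p :=
  g.sharp p (mvfderiv I φ p)

/-- The Hessian of a function: `Hess φ (X,Y) = g(∇_X grad φ, Y)`. -/
def hess [FiniteDimensional ℝ E] (g : Metric I M) (cov : Connection I M) (φ : M → ℝ)
    (X Y : ∀ p : M, TangentSpace I p) (p : M) : ℝ :=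
  g.inner p (cov (grad g φ) p (X p)) (Y p)

/-- The covariant derivative of a field `A` of endomorphisms: `(∇_V A) X = ∇_V (A X) - A (∇_V X)`. -/
def covEndo (cov : Connection I M) (A : ∀ p : M, TangentSpace I p → TangentSpace I p)
    (V X : ∀ p : M, TangentSpace I p) (p : M) : TangentSpace I p :=
  cov (fun q => A q (X q)) p (V p) - A p (cov X p (V p))

/-! ### Hypersurfaces -/

/-- `f` is an isometric immersion of `(M, g)` into `(M', g')`. (Since `g` is nondegenerate, the
differential is injective.) -/
structure IsIsometricImmersion (g : Metric I M) (g' : Metric I' M') (f : M → M') : Prop where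
  smooth : ContMDiff I I' ∞ f
  isometric : ∀ (p : M) (v w : TangentSpace I p),
    g'.inner (f p) (mfderiv I I' f p v) (mfderiv I I' f p w) = g.inner p v w

/-- `N` is a smooth field of unit normal vectors along `f`: `g'(N,N) = ±1`. -/
structure IsUnitNormal (I : ModelWithCorners ℝ E H) (g' : Metric I' M')
    (f : M → M') (N : ∀ p : M, TangentSpace I' (f p)) : Prop where
  smooth : SmoothAlong I f N
  normal : ∀ (p : M) (v : TangentSpace I p), g'.inner (f p) (N p) (mfderiv I I' f p v) = 0
  unit : ∀ p : M, g'.inner (f p) (N p) (N p) = 1 ∨ g'.inner (f p) (N p) (N p) = -1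

/-- The tangential part of a vector `w` of `M'` at `f p`: the vector `u` tangent to `M` at `p`
with `g(u, x) = g'(w, df x)` for all `x`. For an isometric immersion, `df u` is the orthogonal
projection of `w` onto the image of `df`. -/
def tangential [FiniteDimensional ℝ E] (g : Metric I M) (g' : Metric I' M') (f : M → M') (p : M)
    (w : TangentSpace I' (f p)) : TangentSpace I p :=
  g.sharp p ((g'.inner (f p) w).comp (mfderiv I I' f p))

/-- The covariant derivative along `f` (pull-back connection) of a vector field `W` along `f`.
With `W = ∑ Wⁱ · (∂ᵢ ∘ f)` in the coordinate frame `∂ᵢ` given by the preferred chart at `f p`,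
it is `v ↦ ∑ dWⁱ(v) ∂ᵢ + ∑ Wⁱ(p) ∇'_{df v} ∂ᵢ`; the field `∑ Wⁱ(p) ∂ᵢ` is
`FiberBundle.extend E' (W p)`. -/
def covAlong (I : ModelWithCorners ℝ E H) (cov' : Connection I' M') (f : M → M')
    (W : ∀ p : M, TangentSpace I' (f p)) (p : M) :
    TangentSpace I p →L[ℝ] TangentSpace I' (f p) :=
  ((trivializationAt E' (TangentSpace I' : M' → Type _) (f p)).symmL ℝ (f p)).comp
      (mvfderiv I (fun q =>
        (trivializationAt E' (TangentSpace I' : M' → Type _) (f p) ⟨f q, W q⟩).2) p)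
    + (cov' (FiberBundle.extend E' (W p)) (f p)).comp (mfderiv I I' f p)

/-- The Weingarten operator `A x = -(∇'_x N)^T`. -/
def weingarten [FiniteDimensional ℝ E] (g : Metric I M) (g' : Metric I' M')
    (cov' : Connection I' M') (f : M → M') (N : ∀ p : M, TangentSpace I' (f p)) (p : M)
    (x : TangentSpace I p) : TangentSpace I p :=
  -tangential g g' f p (covAlong I cov' f N p x)

/-- The angle function `C = g'(V', N)`. -/
def angle (g' : Metric I' M') (f : M → M') (N : ∀ p : M, TangentSpace I' (f p))
    (V' : ∀ p : M', TangentSpace I' p) (p : M) : ℝ :=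
  g'.inner (f p) (V' (f p)) (N p)

end SemiRiem

end

open Bundle Manifold
open scoped ContDiff Topology
set_option linter.unusedSectionVars false

noncomputable section

namespace SemiRiem

variable {E : Type*} [NormedAddCommGroup E] [NormedSpace ℝ E]
  {H : Type*} [TopologicalSpace H] {I : ModelWithCorners ℝ E H}
  {M : Type*} [TopologicalSpace M] [ChartedSpace H M]
  {E' : Type*} [NormedAddCommGroup E'] [NormedSpace ℝ E']
  {H' : Type*} [TopologicalSpace H'] {I' : ModelWithCorners ℝ E' H'}
  {M' : Type*} [TopologicalSpace M'] [ChartedSpace H' M']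
  [IsManifold I ∞ M] [IsManifold I' ∞ M']

/-! ### Vector fields along a map -/

/-! Write D for the covariant derivative along `f` (`covAlong`), ε = g'(N,N) and V' = df V + εC N.
Since DN = -df∘A, the angle function C = g'(V',N) satisfies dC(Y) = g'(∇'_{df Y} V', N) - g(V, AY).
Differentiating once more along X and subtracting dC(∇_X Y) gives the Hessian as a sum of four kinds
of terms. (1) The second covariant derivative g'(∇'²_{X,Y} V', N). The differentiated Killing
equation controls its symmetric part in the last two slots, and the curvature its skew part in the
first two. A Koszul-type combination determines it, and constant curvature turns it into -(Nσ + cC)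
g(X,Y) (`IsConformalField.inner_secondCov`). (2) g'(∇'_{D_X df Y} V', N). By the Gauss formula
(`covAlong_tangent`) the tangential part cancels against dC(∇_X Y), and the normal part is ε g(AX,Y)
g'(∇'_N V', N) = σ g(AX,Y), by the Killing equation at (N,N) and ε² = 1. (3) -g'(∇'_{df Y} V', df
AX), equal to -g(∇_Y V, AX) + εC g(AY, AX). (4) -g(∇_X V, AY) - g(V, ∇_X(AY)). With the term of
dC(∇_X Y) that involves A, the second summand becomes -g(V, (∇_X A)Y), which is -g((∇_V A)X, Y) by
the Codazzi equation (`covEndo_weingarten_symm`) and the self-adjointness of ∇A.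

The remaining work is calculus along a map. A field along `f` need not be the restriction of an
ambient field, but locally it is a combination, with smooth functions as coefficients, of
restrictions of frame fields. An identity compatible with sums and with the Leibniz rule therefore
needs checking only on restrictions Z ∘ f, where it follows from the chain rule
(`SmoothAlongNear.induction`). In this way metric compatibility, torsion-freeness and the Ricci
identity pass from the ambient connection to D. The pointwise curvature tensor is obtained by the
same tensoriality argument, and an algebraic lemma recovers it from the sectional curvatures of
nondegenerate planes.

Smoothness is required on a neighbourhood because C^∞ at a single point, which bounds no common
neighbourhood for all orders, does not pass to nearby points. -/

variable (I) in
/-- The vector field `W` along `f` is differentiable at `p`. -/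
def DiffAlongAt (f : M → M') (W : ∀ q : M, TangentSpace I' (f q)) (p : M) : Prop :=
  MDifferentiableAt I I'.tangent (fun q => (⟨f q, W q⟩ : TangentBundle I' M')) p

variable (I) in
/-- The vector field `W` along `f` is smooth at `p`. -/
def SmoothAlongAt (f : M → M') (W : ∀ q : M, TangentSpace I' (f q)) (p : M) : Prop :=
  ContMDiffAt I I'.tangent ∞ (fun q => (⟨f q, W q⟩ : TangentBundle I' M')) p

variable (I) in
/-- The vector field `W` along `f` is smooth at all points near `p`. -/
def SmoothAlongNear (f : M → M') (W : ∀ q : M, TangentSpace I' (f q)) (p : M) : Prop :=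
  ∀ᶠ q in 𝓝 p, SmoothAlongAt I f W q

/-- The vector field `X` is smooth at all points near `p`. -/
def SmoothNear (X : ∀ p : M, TangentSpace I p) (p : M) : Prop :=
  ∀ᶠ q in 𝓝 p, SmoothFieldAt X q

variable (I) in
/-- The function `φ` is smooth at all points near `p`. -/
def SmoothFunNear (φ : M → ℝ) (p : M) : Prop :=
  ∀ᶠ q in 𝓝 p, ContMDiffAt I 𝓘(ℝ, ℝ) ∞ φ q

/-- The coordinate representation, in the trivialization at `y`, of a field along `f`. -/
def coordAlong (f : M → M') (W : ∀ q : M, TangentSpace I' (f q)) (y : M') (q : M) : E' :=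
  (trivializationAt E' (TangentSpace I' : M' → Type _) y ⟨f q, W q⟩).2

section along

variable {f : M → M'} {W W₁ W₂ : ∀ q : M, TangentSpace I' (f q)} {p : M} {φ : M → ℝ}

theorem smoothAlongAt_iff : SmoothAlongAt I f W p ↔
    ContMDiffAt I I' ∞ f p ∧ ContMDiffAt I 𝓘(ℝ, E') ∞ (coordAlong f W (f p)) p :=
  contMDiffAt_totalSpace

theorem diffAlongAt_iff : DiffAlongAt I f W p ↔
    MDifferentiableAt I I' f p ∧ MDifferentiableAt I 𝓘(ℝ, E') (coordAlong f W (f p)) p :=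
  mdifferentiableAt_totalSpace ..

theorem SmoothAlongAt.diff (h : SmoothAlongAt I f W p) : DiffAlongAt I f W p :=
  ContMDiffAt.mdifferentiableAt h (by simp)

theorem SmoothAlongNear.self (h : SmoothAlongNear I f W p) : SmoothAlongAt I f W p :=
  h.self_of_nhds

theorem SmoothAlongNear.diff (h : SmoothAlongNear I f W p) : DiffAlongAt I f W p :=
  h.self.diff

theorem SmoothFunNear.eventually (h : SmoothFunNear I φ p) :
    ∀ᶠ q in 𝓝 p, SmoothFunNear I φ q :=
  eventually_eventually_nhds.2 h

theorem SmoothFunNear.diff (h : SmoothFunNear I φ p) : MDifferentiableAt I 𝓘(ℝ, ℝ) φ p :=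
  ContMDiffAt.mdifferentiableAt h.self_of_nhds (by simp)

theorem eventually_mem_baseSet (hf : ContinuousAt f p) :
    ∀ᶠ q in 𝓝 p, f q ∈ (trivializationAt E' (TangentSpace I' : M' → Type _) (f p)).baseSet :=
  hf.eventually ((trivializationAt E' (TangentSpace I' : M' → Type _) (f p)).open_baseSet.mem_nhds
    (FiberBundle.mem_baseSet_trivializationAt' (f p)))

theorem coordAlong_add_eq (y : M') {q : M}
    (hq : f q ∈ (trivializationAt E' (TangentSpace I' : M' → Type _) y).baseSet) :
    coordAlong f (fun q => W₁ q + W₂ q) y q = coordAlong f W₁ y q + coordAlong f W₂ y q :=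
  ((trivializationAt E' (TangentSpace I' : M' → Type _) y).linear ℝ hq).map_add _ _

theorem coordAlong_smul_eq (y : M') {q : M}
    (hq : f q ∈ (trivializationAt E' (TangentSpace I' : M' → Type _) y).baseSet) :
    coordAlong f (fun q => φ q • W q) y q = φ q • coordAlong f W y q :=
  ((trivializationAt E' (TangentSpace I' : M' → Type _) y).linear ℝ hq).map_smul _ _

theorem coordAlong_add (hf : ContinuousAt f p) :
    coordAlong f (fun q => W₁ q + W₂ q) (f p) =ᶠ[𝓝 p]
      fun q => coordAlong f W₁ (f p) q + coordAlong f W₂ (f p) q := by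
  filter_upwards [eventually_mem_baseSet (I' := I') hf] with q hq
  exact coordAlong_add_eq _ hq

theorem coordAlong_smul (hf : ContinuousAt f p) :
    coordAlong f (fun q => φ q • W q) (f p) =ᶠ[𝓝 p]
      fun q => φ q • coordAlong f W (f p) q := by
  filter_upwards [eventually_mem_baseSet (I' := I') hf] with q hq
  exact coordAlong_smul_eq _ hq

theorem SmoothAlongAt.add (h₁ : SmoothAlongAt I f W₁ p) (h₂ : SmoothAlongAt I f W₂ p) :
    SmoothAlongAt I f (fun q => W₁ q + W₂ q) p := by
  rw [smoothAlongAt_iff] at *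
  exact ⟨h₁.1, (h₁.2.add h₂.2).congr_of_eventuallyEq (coordAlong_add h₁.1.continuousAt)⟩

theorem SmoothAlongAt.smul (hφ : ContMDiffAt I 𝓘(ℝ, ℝ) ∞ φ p) (h : SmoothAlongAt I f W p) :
    SmoothAlongAt I f (fun q => φ q • W q) p := by
  rw [smoothAlongAt_iff] at *
  exact ⟨h.1, (hφ.smul h.2).congr_of_eventuallyEq (coordAlong_smul h.1.continuousAt)⟩

theorem SmoothAlongNear.add (h₁ : SmoothAlongNear I f W₁ p) (h₂ : SmoothAlongNear I f W₂ p) :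
    SmoothAlongNear I f (fun q => W₁ q + W₂ q) p := by
  filter_upwards [h₁, h₂] with q a b using a.add b

theorem SmoothAlongNear.smul (hφ : SmoothFunNear I φ p) (h : SmoothAlongNear I f W p) :
    SmoothAlongNear I f (fun q => φ q • W q) p := by
  filter_upwards [hφ, h] with q a b using b.smul a

theorem SmoothFunNear.const (a : ℝ) : SmoothFunNear I (fun _ : M => a) p :=
  Filter.Eventually.of_forall fun _ => contMDiffAt_const

theorem SmoothAlongAt.congr (h : SmoothAlongAt I f W₁ p) (hW : ∀ᶠ q in 𝓝 p, W₁ q = W₂ q) :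
    SmoothAlongAt I f W₂ p :=
  ContMDiffAt.congr_of_eventuallyEq h (by filter_upwards [hW] with q hq; rw [hq])

theorem SmoothAlongNear.congr (h : SmoothAlongNear I f W₁ p) (hW : ∀ᶠ q in 𝓝 p, W₁ q = W₂ q) :
    SmoothAlongNear I f W₂ p := by
  filter_upwards [h, eventually_eventually_nhds.2 hW] with q a b using a.congr b

theorem SmoothFunNear.congr {ψ : M → ℝ} (h : SmoothFunNear I φ p) (hφ : φ =ᶠ[𝓝 p] ψ) :
    SmoothFunNear I ψ p := by
  filter_upwards [h, eventually_eventually_nhds.2 hφ] with q a b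
  exact a.congr_of_eventuallyEq (Filter.EventuallyEq.symm b)

variable {Z : ∀ y : M', TangentSpace I' y}

theorem SmoothFieldAt.comp (hf : ContMDiffAt I I' ∞ f p) (hZ : SmoothFieldAt Z (f p)) :
    SmoothAlongAt I f (fun q => Z (f q)) p :=
  ContMDiffAt.comp p hZ hf

theorem SmoothNear.comp (hf : ContMDiff I I' ∞ f) (hZ : SmoothNear Z (f p)) :
    SmoothAlongNear I f (fun q => Z (f q)) p := by
  filter_upwards [hf.continuous.continuousAt.eventually hZ] with q hq using hq.comp (hf q)

theorem SmoothFunNear.comp {φ : M' → ℝ} (hf : ContMDiff I I' ∞ f) (hφ : SmoothFunNear I' φ (f p)) :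
    SmoothFunNear I (fun q => φ (f q)) p := by
  filter_upwards [hf.continuous.continuousAt.eventually hφ] with q hq
  exact ContMDiffAt.comp q hq (hf q)

/-- Smoothly varying fields along a smooth map are generated, locally and as a module over the
smooth functions, by restrictions of fields with constant coordinates. -/
theorem SmoothAlongNear.induction_frame [FiniteDimensional ℝ E'] (hf : ContMDiff I I' ∞ f)
    (motive : (∀ q : M, TangentSpace I' (f q)) → Prop)
    (congr : ∀ W₁ W₂, SmoothAlongNear I f W₁ p → (∀ᶠ q in 𝓝 p, W₁ q = W₂ q) →
      motive W₁ → motive W₂)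
    (add : ∀ W₁ W₂, SmoothAlongNear I f W₁ p → SmoothAlongNear I f W₂ p →
      motive W₁ → motive W₂ → motive (fun q => W₁ q + W₂ q))
    (smul : ∀ (φ : M → ℝ) W, SmoothFunNear I φ p → SmoothAlongNear I f W p →
      motive W → motive (fun q => φ q • W q))
    (comp : ∀ Z : ∀ y : M', TangentSpace I' y, SmoothNear Z (f p) →
      (∃ v : E', ∀ᶠ z in 𝓝 (f p),
        Z z = (trivializationAt E' (TangentSpace I' : M' → Type _) (f p)).symm z v) →
      motive (fun q => Z (f q)))
    (hW : SmoothAlongNear I f W p) : motive W := by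
  classical
  set e := trivializationAt E' (TangentSpace I' : M' → Type _) (f p) with he
  let b := Module.finBasis ℝ E'
  let s := e.localFrame b
  have hs : ∀ i, SmoothNear (s i) (f p) := by
    intro i
    filter_upwards [e.open_baseSet.mem_nhds (FiberBundle.mem_baseSet_trivializationAt' (f p))]
      with y hy
    exact contMDiffAt_localFrame_of_mem ∞ e b i hy
  have hs' : ∀ i, ∀ᶠ z in 𝓝 (f p), s i z = e.symm z (b i) := by
    intro i
    filter_upwards [e.open_baseSet.mem_nhds (FiberBundle.mem_baseSet_trivializationAt' (f p))]
      with z hz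
    simp [s, e.localFrame_apply_of_mem_baseSet b hz, Trivialization.basisAt]
  -- The coefficients are the coordinates of `W` in the trivialization at `f p`, so that W = ∑ cᵢ
  -- (sᵢ ∘ f) near `p`.
  let c : Fin (Module.finrank ℝ E') → M → ℝ := fun i q => b.repr (coordAlong f W (f p) q) i
  have hc : ∀ i, SmoothFunNear I (c i) p := by
    intro i
    have hb := eventually_mem_baseSet (I' := I') (hf p).continuousAt
    filter_upwards [hW, hb] with q hq hbq
    have h1 : ContMDiffAt I 𝓘(ℝ, E') ∞ (coordAlong f W (f p)) q :=
      ((e.contMDiffAt_iff (e.mem_source.2 hbq)).1 hq).2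
    exact ((LinearMap.toContinuousLinearMap (b.coord i)).contMDiff.contMDiffAt.comp q h1)
  have hsum : ∀ t : Finset (Fin (Module.finrank ℝ E')),
      SmoothAlongNear I f (fun q => ∑ i ∈ t, c i q • s i (f q)) p ∧
        motive (fun q => ∑ i ∈ t, c i q • s i (f q)) := by
    intro t
    induction t using Finset.induction_on with
    | empty =>
      -- The empty sum is covered by `comp`, since the zero field has the constant coordinates 0.
      have h0 := comp (fun _ => 0) (Filter.Eventually.of_forall
        fun y => (contMDiff_zeroSection ℝ (TangentSpace I' : M' → Type _)).contMDiffAt)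
        ⟨0, by
          filter_upwards [e.open_baseSet.mem_nhds
            (FiberBundle.mem_baseSet_trivializationAt' (f p))] with z hz
          rw [← e.coe_symmₗ (R := ℝ), map_zero]
          exact hz⟩
      refine ⟨?_, by simpa using h0⟩
      simp only [Finset.sum_empty]
      exact SmoothNear.comp (Z := fun _ => 0) hf (Filter.Eventually.of_forall
        fun y => (contMDiff_zeroSection ℝ (TangentSpace I' : M' → Type _)).contMDiffAt)
    | insert i t hi ih =>
      have h1 : SmoothAlongNear I f (fun q => s i (f q)) p := (hs i).comp hf
      have h2 := h1.smul (hc i)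
      have h3 := smul (c i) _ (hc i) h1 (comp _ (hs i) ⟨b i, hs' i⟩)
      simp only [Finset.sum_insert hi]
      exact ⟨h2.add ih.1, add _ _ h2 ih.1 h3 ih.2⟩
  refine congr _ _ (hsum Finset.univ).1 ?_ (hsum Finset.univ).2
  filter_upwards [eventually_mem_baseSet (I' := I') (hf p).continuousAt] with q hq
  have h1 : ∀ i, s i (f q) = (e.linearEquivAt ℝ (f q) hq).symm (b i) := by
    intro i
    simp only [s, e.localFrame_apply_of_mem_baseSet b hq, Trivialization.basisAt]
    simp
  simp only [h1, ← map_smul, ← map_sum]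
  rw [LinearEquiv.symm_apply_eq]
  exact b.sum_repr _

/-- Smoothly varying fields along a smooth map are generated, locally and as a module over the
smooth functions, by restrictions of smooth fields. -/
theorem SmoothAlongNear.induction [FiniteDimensional ℝ E'] (hf : ContMDiff I I' ∞ f)
    (motive : (∀ q : M, TangentSpace I' (f q)) → Prop)
    (congr : ∀ W₁ W₂, SmoothAlongNear I f W₁ p → (∀ᶠ q in 𝓝 p, W₁ q = W₂ q) →
      motive W₁ → motive W₂)
    (add : ∀ W₁ W₂, SmoothAlongNear I f W₁ p → SmoothAlongNear I f W₂ p →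
      motive W₁ → motive W₂ → motive (fun q => W₁ q + W₂ q))
    (smul : ∀ (φ : M → ℝ) W, SmoothFunNear I φ p → SmoothAlongNear I f W p →
      motive W → motive (fun q => φ q • W q))
    (comp : ∀ Z : ∀ y : M', TangentSpace I' y, SmoothNear Z (f p) → motive (fun q => Z (f q)))
    (hW : SmoothAlongNear I f W p) : motive W :=
  hW.induction_frame hf motive congr add smul fun Z hZ _ => comp Z hZ

end along

/-! ### The covariant derivative along a map -/

theorem mvfderiv_congr {F : Type*} [NormedAddCommGroup F] [NormedSpace ℝ F] {φ ψ : M → F} {p : M}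
    (h : φ =ᶠ[𝓝 p] ψ) : mvfderiv I φ p = mvfderiv I ψ p := by
  ext v
  simp only [mvfderiv, h.mfderiv_eq]
  rfl

/-- The extension of a tangent vector to a vector field which has constant coordinates in the
preferred trivialization. -/
abbrev fieldExtend {y : M'} (w : TangentSpace I' y) : ∀ z : M', TangentSpace I' z :=
  FiberBundle.extend E' w

theorem fieldExtend_self {y : M'} (w : TangentSpace I' y) : fieldExtend w y = w :=
  FiberBundle.extend_apply_self E' w

theorem diffFieldAt_fieldExtend {y : M'} (w : TangentSpace I' y) :
    DiffFieldAt (fieldExtend w) y :=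
  FiberBundle.mdifferentiableAt_extend I' E' w

theorem eventually_fieldExtend {y : M'} (w : TangentSpace I' y) : ∀ᶠ z in 𝓝 y,
    z ∈ (trivializationAt E' (TangentSpace I' : M' → Type _) y).baseSet ∧ fieldExtend w z =
      (trivializationAt E' (TangentSpace I' : M' → Type _) y).symmL ℝ z
        ((trivializationAt E' (TangentSpace I' : M' → Type _) y).continuousLinearMapAt ℝ y w) := by
  have hy : y ∈ (trivializationAt E' (TangentSpace I' : M' → Type _) y).baseSet :=
    FiberBundle.mem_baseSet_trivializationAt' y
  filter_upwards [(trivializationAt E' (TangentSpace I' : M' → Type _) y).open_baseSet.mem_nhds hy]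
    with z hz
  refine ⟨hz, ?_⟩
  rw [Trivialization.symmL_apply _ hz, Trivialization.continuousLinearMapAt_apply,
    Trivialization.coe_linearMapAt_of_mem _ hy]
  rfl

theorem smoothNear_fieldExtend {y : M'} (w : TangentSpace I' y) :
    SmoothNear (fieldExtend w) y := by
  obtain ⟨s, hs, h⟩ := FiberBundle.exists_contMDiffOn_extend (k := ∞) I' E' w
  filter_upwards [eventually_mem_nhds_iff.2 hs] with z hz using h.contMDiffAt hz

theorem connection_fieldExtend_add (cov' : Connection I' M') (y : M')
    (w₁ w₂ : TangentSpace I' y) :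
    cov' (fieldExtend (w₁ + w₂)) y = cov' (fieldExtend w₁) y + cov' (fieldExtend w₂) y := by
  rw [← cov'.isCovariantDerivativeOnUniv.add (diffFieldAt_fieldExtend w₁)
    (diffFieldAt_fieldExtend w₂)]
  refine cov'.isCovariantDerivativeOnUniv.congr_of_eventuallyEq (diffFieldAt_fieldExtend _)
    (mdifferentiableAt_add_section (diffFieldAt_fieldExtend w₁) (diffFieldAt_fieldExtend w₂))
    Filter.univ_mem ?_
  filter_upwards [eventually_fieldExtend w₁, eventually_fieldExtend w₂,
    eventually_fieldExtend (w₁ + w₂)] with z h₁ h₂ h₃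
  rw [h₃.2, Pi.add_apply, h₁.2, h₂.2, map_add, map_add]

theorem connection_fieldExtend_smul (cov' : Connection I' M') (y : M') (a : ℝ)
    (w : TangentSpace I' y) :
    cov' (fieldExtend (a • w)) y = a • cov' (fieldExtend w) y := by
  rw [← cov'.isCovariantDerivativeOnUniv.smul_const a (diffFieldAt_fieldExtend w)]
  refine cov'.isCovariantDerivativeOnUniv.congr_of_eventuallyEq (diffFieldAt_fieldExtend _)
    ((diffFieldAt_fieldExtend w).smul_const_section) Filter.univ_mem ?_
  filter_upwards [eventually_fieldExtend w, eventually_fieldExtend (a • w)] with z h₁ h₂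
  rw [h₂.2, Pi.smul_apply, h₁.2, map_smul, map_smul]

theorem symmL_coordAlong {f : M → M'} (W : ∀ q : M, TangentSpace I' (f q)) (p : M) :
    (trivializationAt E' (TangentSpace I' : M' → Type _) (f p)).symmL ℝ (f p)
      (coordAlong f W (f p) p) = W p := by
  have hy : f p ∈ (trivializationAt E' (TangentSpace I' : M' → Type _) (f p)).baseSet :=
    FiberBundle.mem_baseSet_trivializationAt' (f p)
  rw [Trivialization.symmL_apply _ hy]
  exact Trivialization.symm_apply_apply_mk _ hy _

/-- A connection is the flat connection of the trivialization at `y` plus a zeroth order term. -/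
theorem connection_eq [FiniteDimensional ℝ E'] (cov' : Connection I' M')
    {Z : ∀ y : M', TangentSpace I' y} {y : M'} (hZ : DiffFieldAt Z y) (u : TangentSpace I' y) :
    cov' Z y u = (trivializationAt E' (TangentSpace I' : M' → Type _) y).symmL ℝ y
      (mvfderiv I' (coordAlong id Z y) y u) + cov' (fieldExtend (Z y)) y u := by
  set e := trivializationAt E' (TangentSpace I' : M' → Type _) y with he
  have hy : y ∈ e.baseSet := FiberBundle.mem_baseSet_trivializationAt' y
  -- The Leibniz terms of ∇' and of the flat connection cancel, so their difference depends on Z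
  -- only through Z y. It is then evaluated on the extension with constant coordinates, whose flat
  -- derivative is zero.
  have htens : TensorialAt I' E' (fun Z : (∀ y : M', TangentSpace I' y) =>
      cov' Z y u - e.symmL ℝ y (mvfderiv I' (coordAlong id Z y) y u)) y := by
    constructor
    · intro φ Z hφ hZ
      have h1 := cov'.isCovariantDerivativeOnUniv.leibniz hZ hφ
      have hd : MDifferentiableAt I' 𝓘(ℝ, E') (coordAlong id Z y) y :=
        (diffAlongAt_iff (I := I') (f := id)).1 hZ |>.2
      have h2 : mvfderiv I' (coordAlong id (φ • Z) y) y =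
          mvfderiv I' (φ • coordAlong id Z y) y :=
        mvfderiv_congr (coordAlong_smul (f := id) continuousAt_id)
      have h3 : e.symmL ℝ y (coordAlong id Z y y) = Z y :=
        symmL_coordAlong (f := id) Z y
      rw [h1, h2, mvfderiv_smul hφ hd]
      simp only [add_apply, _root_.smul_apply, ContinuousLinearMap.smulRight_apply, map_add, map_smul,
        h3, smul_sub]
      abel
    · intro Z₁ Z₂ hZ₁ hZ₂
      have h1 := cov'.isCovariantDerivativeOnUniv.add hZ₁ hZ₂
      have hd₁ : MDifferentiableAt I' 𝓘(ℝ, E') (coordAlong id Z₁ y) y :=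
        (diffAlongAt_iff (I := I') (f := id)).1 hZ₁ |>.2
      have hd₂ : MDifferentiableAt I' 𝓘(ℝ, E') (coordAlong id Z₂ y) y :=
        (diffAlongAt_iff (I := I') (f := id)).1 hZ₂ |>.2
      have h2 : mvfderiv I' (coordAlong id (Z₁ + Z₂) y) y =
          mvfderiv I' (coordAlong id Z₁ y + coordAlong id Z₂ y) y :=
        mvfderiv_congr (coordAlong_add (f := id) continuousAt_id)
      rw [h1, h2, mvfderiv_add hd₁ hd₂]
      simp only [add_apply, map_add]
      abel
  have h := htens.pointwise hZ (diffFieldAt_fieldExtend (Z y)) (by simp)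
  have h0 : mvfderiv I' (coordAlong id (fieldExtend (Z y)) y) y = 0 := by
    rw [mvfderiv_congr (ψ := fun _ => (e ⟨y, Z y⟩).2), mvfderiv_const]
    filter_upwards [e.open_baseSet.mem_nhds hy] with z hz
    change (e ⟨z, e.symm z (e ⟨y, Z y⟩).2⟩).2 = _
    rw [e.apply_mk_symm hz]
  change _ = _ - e.symmL ℝ y (mvfderiv I' (coordAlong id (fieldExtend (Z y)) y) y u) at h
  rw [h0] at h
  simp only [zero_apply, map_zero, sub_zero] at h
  rw [← h]
  abel

section covAlong

variable {cov' : Connection I' M'} {f : M → M'} {W W₁ W₂ : ∀ q : M, TangentSpace I' (f q)} {p : M}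
  {φ : M → ℝ}

theorem covAlong_apply (v : TangentSpace I p) : covAlong I cov' f W p v =
    (trivializationAt E' (TangentSpace I' : M' → Type _) (f p)).symmL ℝ (f p)
      (mvfderiv I (coordAlong f W (f p)) p v)
    + cov' (fieldExtend (W p)) (f p) (mfderiv I I' f p v) := rfl

theorem covAlong_congr (h : ∀ᶠ q in 𝓝 p, W₁ q = W₂ q) :
    covAlong I cov' f W₁ p = covAlong I cov' f W₂ p := by
  ext v
  have h1 : mvfderiv I (coordAlong f W₁ (f p)) p = mvfderiv I (coordAlong f W₂ (f p)) p :=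
    mvfderiv_congr (by filter_upwards [h] with q hq; simp [coordAlong, hq])
  rw [covAlong_apply, covAlong_apply, h1, h.self_of_nhds]

theorem covAlong_add (h₁ : DiffAlongAt I f W₁ p) (h₂ : DiffAlongAt I f W₂ p)
    (v : TangentSpace I p) : covAlong I cov' f (fun q => W₁ q + W₂ q) p v =
      covAlong I cov' f W₁ p v + covAlong I cov' f W₂ p v := by
  rw [diffAlongAt_iff] at h₁ h₂
  have h : mvfderiv I (coordAlong f (fun q => W₁ q + W₂ q) (f p)) p =
      mvfderiv I (coordAlong f W₁ (f p) + coordAlong f W₂ (f p)) p :=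
    mvfderiv_congr (coordAlong_add h₁.1.continuousAt)
  rw [covAlong_apply, covAlong_apply, covAlong_apply, h, mvfderiv_add h₁.2 h₂.2,
    connection_fieldExtend_add]
  simp only [add_apply, map_add]
  abel

theorem covAlong_smul (hφ : MDifferentiableAt I 𝓘(ℝ, ℝ) φ p) (hW : DiffAlongAt I f W p)
    (v : TangentSpace I p) : covAlong I cov' f (fun q => φ q • W q) p v =
      φ p • covAlong I cov' f W p v + mvfderiv I φ p v • W p := by
  rw [diffAlongAt_iff] at hW
  have h : mvfderiv I (coordAlong f (fun q => φ q • W q) (f p)) p =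
      mvfderiv I (φ • coordAlong f W (f p)) p :=
    mvfderiv_congr (coordAlong_smul hW.1.continuousAt)
  rw [covAlong_apply, covAlong_apply, h, mvfderiv_smul hφ hW.2,
    connection_fieldExtend_smul]
  simp only [add_apply, _root_.smul_apply, ContinuousLinearMap.smulRight_apply, map_add, map_smul,
    symmL_coordAlong, smul_add]
  abel

/-- The chain rule applied to the coordinate part of `connection_eq`; the zeroth order parts agree
literally. This is the base case of every induction on fields along `f`. -/
theorem covAlong_comp [FiniteDimensional ℝ E'] {Z : ∀ y : M', TangentSpace I' y}
    (hf : MDifferentiableAt I I' f p) (hZ : DiffFieldAt Z (f p)) (v : TangentSpace I p) :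
    covAlong I cov' f (fun q => Z (f q)) p v = cov' Z (f p) (mfderiv I I' f p v) := by
  have hd : MDifferentiableAt I' 𝓘(ℝ, E') (coordAlong id Z (f p)) (f p) :=
    (diffAlongAt_iff (I := I') (f := id)).1 hZ |>.2
  have h : mvfderiv I (coordAlong f (fun q => Z (f q)) (f p)) p v =
      mvfderiv I' (coordAlong id Z (f p)) (f p) (mfderiv I I' f p v) :=
    mfderiv_comp_apply p hd hf v
  rw [covAlong_apply, h, connection_eq cov' hZ]

end covAlong

/-! ### Smoothness of derived fields and functions -/

theorem smoothNear_iff_along {X : ∀ p : M, TangentSpace I p} {p : M} :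
    SmoothNear X p ↔ SmoothAlongNear I id X p := Iff.rfl

theorem SmoothNear.self {X : ∀ p : M, TangentSpace I p} {p : M} (h : SmoothNear X p) :
    SmoothFieldAt X p := h.self_of_nhds

theorem SmoothFieldAt.diff {X : ∀ p : M, TangentSpace I p} {p : M} (h : SmoothFieldAt X p) :
    DiffFieldAt X p := ContMDiffAt.mdifferentiableAt h (by simp)

theorem SmoothNear.diff {X : ∀ p : M, TangentSpace I p} {p : M} (h : SmoothNear X p) :
    DiffFieldAt X p := h.self.diff

theorem SmoothNear.eventually {X : ∀ p : M, TangentSpace I p} {p : M} (h : SmoothNear X p) :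
    ∀ᶠ q in 𝓝 p, SmoothNear X q := eventually_eventually_nhds.2 h

theorem SmoothField.near {X : ∀ p : M, TangentSpace I p} (h : SmoothField X) (p : M) :
    SmoothNear X p := Filter.Eventually.of_forall fun q => h q

theorem SmoothAlong.near {f : M → M'} {W : ∀ q : M, TangentSpace I' (f q)}
    (h : SmoothAlong I f W) (p : M) : SmoothAlongNear I f W p :=
  Filter.Eventually.of_forall fun q => h q

theorem SmoothNear.add {X Y : ∀ p : M, TangentSpace I p} {p : M} (hX : SmoothNear X p)
    (hY : SmoothNear Y p) : SmoothNear (fun q => X q + Y q) p :=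
  SmoothAlongNear.add (f := id) hX hY

theorem SmoothNear.smul {φ : M → ℝ} {X : ∀ p : M, TangentSpace I p} {p : M}
    (hφ : SmoothFunNear I φ p) (hX : SmoothNear X p) : SmoothNear (fun q => φ q • X q) p :=
  SmoothAlongNear.smul (f := id) hφ hX

/-- The differential of a smooth map applied to a smooth field. -/
theorem SmoothFieldAt.mfderiv_apply {f : M → M'} {X : ∀ p : M, TangentSpace I p} {p : M}
    (hf : ContMDiffAt I I' ∞ f p) (hX : SmoothFieldAt X p) :
    SmoothAlongAt I f (fun q => mfderiv I I' f q (X q)) p :=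
  ContMDiffAt.clm_apply_of_inCoordinates (hf.mfderiv_const (m := ∞) (by simp)) hX hf

theorem SmoothNear.mfderiv_apply {f : M → M'} {X : ∀ p : M, TangentSpace I p} {p : M}
    (hf : ContMDiff I I' ∞ f) (hX : SmoothNear X p) :
    SmoothAlongNear I f (fun q => mfderiv I I' f q (X q)) p := by
  filter_upwards [hX] with q hq using hq.mfderiv_apply (hf q)

/-- The derivative of a smooth function along a smooth field. -/
theorem SmoothFunNear.mvfderiv_apply {φ : M → ℝ} {X : ∀ p : M, TangentSpace I p} {p : M}
    (hφ : SmoothFunNear I φ p) (hX : SmoothNear X p) :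
    SmoothFunNear I (fun q => mvfderiv I φ q (X q)) p := by
  filter_upwards [hφ, hX] with q h₁ h₂
  exact (contMDiff_snd_tangentBundle_modelSpace ℝ 𝓘(ℝ, ℝ)).contMDiffAt.comp q
    (h₂.mfderiv_apply h₁)

section inner

variable {g' : Metric I' M'} {f : M → M'} {W₁ W₂ : ∀ q : M, TangentSpace I' (f q)} {p : M}

theorem SmoothAlongAt.inner (h₁ : SmoothAlongAt I f W₁ p) (h₂ : SmoothAlongAt I f W₂ p) :
    ContMDiffAt I 𝓘(ℝ, ℝ) ∞ (fun q => g'.inner (f q) (W₁ q) (W₂ q)) p := by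
  have hb := (smoothAlongAt_iff.1 h₁).1
  have : ContMDiffAt I (I'.prod 𝓘(ℝ)) ∞
      (fun m ↦ TotalSpace.mk' ℝ (E := Bundle.Trivial M' ℝ) (f m)
        (g'.inner (f m) (W₁ m) (W₂ m))) p := by
    apply ContMDiffAt.clm_bundle_apply₂ (F₁ := E') (F₂ := E')
    · exact ContMDiffAt.comp p g'.contMDiff.contMDiffAt hb
    · exact h₁
    · exact h₂
  simp only [contMDiffAt_totalSpace] at this
  exact this.2

theorem SmoothAlongNear.inner (h₁ : SmoothAlongNear I f W₁ p) (h₂ : SmoothAlongNear I f W₂ p) :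
    SmoothFunNear I (fun q => g'.inner (f q) (W₁ q) (W₂ q)) p := by
  filter_upwards [h₁, h₂] with q a b using a.inner b

theorem SmoothNear.inner {g : Metric I M} {X Y : ∀ p : M, TangentSpace I p} (hX : SmoothNear X p)
    (hY : SmoothNear Y p) : SmoothFunNear I (fun q => g.inner q (X q) (Y q)) p :=
  SmoothAlongNear.inner (f := id) hX hY

end inner

/-! ### Smoothness of covariant derivatives, and metric compatibility along a map -/

section connection

variable {g' : Metric I' M'} {cov' : Connection I' M'}

/-- The clause `IsLeviCivita.smooth` ranges over all open sets, so it applies on a neighbourhood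
where `Z` is smooth even if `Z` is not globally smooth. -/
theorem SmoothNear.connection (hcov' : IsLeviCivita g' cov') {Z : ∀ y : M', TangentSpace I' y}
    {y : M'} (hZ : SmoothNear Z y) : ∀ᶠ z in 𝓝 y, ContMDiffAt I' (I'.prod 𝓘(ℝ, E' →L[ℝ] E')) ∞
      (fun z => TotalSpace.mk' (E' →L[ℝ] E')
        (E := fun z : M' => TangentSpace I' z →L[ℝ] TangentSpace I' z) z (cov' Z z)) z := by
  obtain ⟨U, hU, hUo, hyU⟩ := eventually_nhds_iff.1 hZ
  have h := (hcov'.smooth U hUo).contMDiff (σ := Z) (fun z hz => (hU z hz).contMDiffWithinAt)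
  filter_upwards [hUo.mem_nhds hyU] with z hz using (h z hz).contMDiffAt (hUo.mem_nhds hz)

theorem SmoothNear.connection_apply (hcov' : IsLeviCivita g' cov') {f : M → M'}
    (hf : ContMDiff I I' ∞ f) {Z : ∀ y : M', TangentSpace I' y}
    {W : ∀ q : M, TangentSpace I' (f q)} {p : M} (hZ : SmoothNear Z (f p))
    (hW : SmoothAlongNear I f W p) :
    SmoothAlongNear I f (fun q => cov' Z (f q) (W q)) p := by
  filter_upwards [hf.continuous.continuousAt.eventually (hZ.connection hcov'), hW] with q h₁ h₂
  exact ContMDiffAt.clm_bundle_apply (b := f) (ContMDiffAt.comp q h₁ (hf q)) h₂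

theorem SmoothNear.connection_apply_id (hcov' : IsLeviCivita g' cov')
    {Z Y : ∀ y : M', TangentSpace I' y} {y : M'} (hZ : SmoothNear Z y) (hY : SmoothNear Y y) :
    SmoothNear (fun z => cov' Z z (Y z)) y :=
  SmoothNear.connection_apply (f := id) hcov' contMDiff_id hZ hY

variable [FiniteDimensional ℝ E'] {f : M → M'} {p : M}

/-- Smoothness cannot be read off the definition of `covAlong`, whose trivialization changes with
the base point. It is checked on restrictions and propagated by the Leibniz rule. -/
theorem SmoothAlongNear.covAlong_apply (hcov' : IsLeviCivita g' cov') (hf : ContMDiff I I' ∞ f)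
    {W : ∀ q : M, TangentSpace I' (f q)} (hW : SmoothAlongNear I f W p)
    {X : ∀ p : M, TangentSpace I p} (hX : SmoothNear X p) :
    SmoothAlongNear I f (fun q => covAlong I cov' f W q (X q)) p := by
  refine SmoothAlongNear.induction hf
    (fun W => SmoothAlongNear I f (fun q => covAlong I cov' f W q (X q)) p) ?_ ?_ ?_ ?_ hW
  · intro W₁ W₂ h₁ he h
    refine h.congr ?_
    filter_upwards [eventually_eventually_nhds.2 he] with q hq
    rw [covAlong_congr hq]
  · intro W₁ W₂ h₁ h₂ h₃ h₄
    refine (h₃.add h₄).congr ?_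
    filter_upwards [h₁, h₂] with q a b
    rw [covAlong_add a.diff b.diff]
  · intro φ W hφ hW h
    refine ((h.smul hφ).add (hW.smul (hφ.mvfderiv_apply hX))).congr ?_
    filter_upwards [hφ.eventually, hW] with q a b
    rw [covAlong_smul a.diff b.diff]
  · intro Z hZ
    refine (hZ.connection_apply hcov' hf (hX.mfderiv_apply hf)).congr ?_
    filter_upwards [hf.continuous.continuousAt.eventually hZ] with q hq
    rw [covAlong_comp ((hf q).mdifferentiableAt (by simp)) hq.diff]

/-- Compatibility of the covariant derivative along a map with the metric. -/
theorem mvfderiv_inner_along (hcov' : IsLeviCivita g' cov') (hf : ContMDiff I I' ∞ f)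
    {W₁ W₂ : ∀ q : M, TangentSpace I' (f q)} (h₁ : SmoothAlongNear I f W₁ p)
    (h₂ : SmoothAlongNear I f W₂ p) (v : TangentSpace I p) :
    mvfderiv I (fun q => g'.inner (f q) (W₁ q) (W₂ q)) p v =
      g'.inner (f p) (covAlong I cov' f W₁ p v) (W₂ p) +
        g'.inner (f p) (W₁ p) (covAlong I cov' f W₂ p v) := by
  have hfd : MDifferentiableAt I I' f p := (hf p).mdifferentiableAt (by simp)
  refine SmoothAlongNear.induction hf
    (fun W₁ => mvfderiv I (fun q => g'.inner (f q) (W₁ q) (W₂ q)) p v =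
      g'.inner (f p) (covAlong I cov' f W₁ p v) (W₂ p) +
        g'.inner (f p) (W₁ p) (covAlong I cov' f W₂ p v)) ?_ ?_ ?_ ?_ h₁
  · intro W₁ W₃ h₁ he h
    rw [← covAlong_congr he, ← he.self_of_nhds, ← h]
    refine DFunLike.congr_fun (mvfderiv_congr (I := I) ?_) v
    filter_upwards [he] with q hq using by rw [hq]
  · intro W₁ W₃ h₁ h₃ a b
    rw [covAlong_add h₁.diff h₃.diff]
    have := mvfderiv_add (h₁.inner (g' := g') h₂).diff (h₃.inner (g' := g') h₂).diff
    simp only [map_add, add_apply]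
    change mvfderiv I ((fun q => g'.inner (f q) (W₁ q) (W₂ q)) +
      (fun q => g'.inner (f q) (W₃ q) (W₂ q))) p v = _
    rw [this, add_apply, a, b]
    ring
  · intro φ W₁ hφ h₁ a
    rw [covAlong_smul hφ.diff h₁.diff]
    have := mvfderiv_mul hφ.diff (h₁.inner (g' := g') h₂).diff
    simp only [map_add, map_smul, add_apply, _root_.smul_apply, smul_eq_mul]
    change mvfderiv I (φ * (fun q => g'.inner (f q) (W₁ q) (W₂ q))) p v = _
    rw [this]
    simp only [add_apply, _root_.smul_apply, smul_eq_mul, a]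
    ring
  -- With the first field now a restriction, a second induction reduces the other field to a
  -- restriction as well, and the ambient compatibility applies.
  · intro Z hZ
    refine SmoothAlongNear.induction hf
      (fun W₂ => mvfderiv I (fun q => g'.inner (f q) (Z (f q)) (W₂ q)) p v =
        g'.inner (f p) (covAlong I cov' f (fun q => Z (f q)) p v) (W₂ p) +
          g'.inner (f p) (Z (f p)) (covAlong I cov' f W₂ p v)) ?_ ?_ ?_ ?_ h₂
    · intro W₁ W₃ h₁ he h
      rw [← covAlong_congr he, ← he.self_of_nhds, ← h]
      refine DFunLike.congr_fun (mvfderiv_congr (I := I) ?_) v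
      filter_upwards [he] with q hq using by rw [hq]
    · intro W₁ W₃ h₁ h₃ a b
      rw [covAlong_add h₁.diff h₃.diff]
      have := mvfderiv_add ((hZ.comp hf).inner (g' := g') h₁).diff
        ((hZ.comp hf).inner (g' := g') h₃).diff
      simp only [map_add]
      change mvfderiv I ((fun q => g'.inner (f q) (Z (f q)) (W₁ q)) +
        (fun q => g'.inner (f q) (Z (f q)) (W₃ q))) p v = _
      rw [this, add_apply, a, b]
      ring
    · intro φ W₁ hφ h₁ a
      rw [covAlong_smul hφ.diff h₁.diff]
      have := mvfderiv_mul hφ.diff ((hZ.comp hf).inner (g' := g') h₁).diff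
      simp only [map_add, map_smul, smul_eq_mul]
      change mvfderiv I (φ * (fun q => g'.inner (f q) (Z (f q)) (W₁ q))) p v = _
      rw [this]
      simp only [add_apply, _root_.smul_apply, smul_eq_mul, a]
      ring
    · intro Y hY
      rw [covAlong_comp hfd hZ.diff, covAlong_comp hfd hY.diff,
        ← hcov'.compatible Z Y (f p) _ hZ.diff hY.diff]
      exact mfderiv_comp_apply p
        (SmoothFunNear.diff (SmoothNear.inner (g := g') hZ hY)) hfd v

end connection

/-! ### Tensoriality -/

/-- A field with constant coordinates is recovered, as a germ, from its value at `y`. Hence the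
induction may be based on the fields `fieldExtend w` alone, the ones used to define the linear map
in `exists_linear_of_tensorial`. -/
theorem eq_fieldExtend_of_frame {y : M'} {Z : ∀ z : M', TangentSpace I' z} {v : E'}
    (hZ : ∀ᶠ z in 𝓝 y,
      Z z = (trivializationAt E' (TangentSpace I' : M' → Type _) y).symm z v) :
    ∀ᶠ z in 𝓝 y, fieldExtend (Z y) z = Z z := by
  filter_upwards [hZ, eventually_fieldExtend (Z y)] with z h₁ h₂
  have hy : y ∈ (trivializationAt E' (TangentSpace I' : M' → Type _) y).baseSet :=
    FiberBundle.mem_baseSet_trivializationAt' y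
  rw [h₂.2, h₁, hZ.self_of_nhds, ← Trivialization.symmL_apply (R := ℝ) _ hy,
    Trivialization.continuousLinearMapAt_symmL _ hy, Trivialization.symmL_apply _ h₂.1]

theorem SmoothAlongNear.induction_extend [FiniteDimensional ℝ E'] {f : M → M'}
    {W : ∀ q : M, TangentSpace I' (f q)} {p : M} (hf : ContMDiff I I' ∞ f)
    (motive : (∀ q : M, TangentSpace I' (f q)) → Prop)
    (congr : ∀ W₁ W₂, SmoothAlongNear I f W₁ p → (∀ᶠ q in 𝓝 p, W₁ q = W₂ q) →
      motive W₁ → motive W₂)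
    (add : ∀ W₁ W₂, SmoothAlongNear I f W₁ p → SmoothAlongNear I f W₂ p →
      motive W₁ → motive W₂ → motive (fun q => W₁ q + W₂ q))
    (smul : ∀ (φ : M → ℝ) W, SmoothFunNear I φ p → SmoothAlongNear I f W p →
      motive W → motive (fun q => φ q • W q))
    (extend : ∀ w : TangentSpace I' (f p), motive (fun q => fieldExtend w (f q)))
    (hW : SmoothAlongNear I f W p) : motive W :=
  SmoothAlongNear.induction_frame hf motive congr add smul (hW := hW) fun Z _ ⟨_, hv⟩ =>
    congr _ _ ((smoothNear_fieldExtend (Z (f p))).comp hf)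
      (hf.continuous.continuousAt.eventually (eq_fieldExtend_of_frame hv)) (extend (Z (f p)))

/-- An operation on vector fields which is linear over the smooth functions is given by a linear
map. -/
theorem exists_linear_of_tensorial [FiniteDimensional ℝ E] {A : Type*} [AddCommGroup A]
    [Module ℝ A] {p : M} (Φ : (∀ q : M, TangentSpace I q) → A)
    (congr : ∀ X Y, SmoothNear X p → (∀ᶠ q in 𝓝 p, X q = Y q) → Φ X = Φ Y)
    (add : ∀ X Y, SmoothNear X p → SmoothNear Y p → Φ (fun q => X q + Y q) = Φ X + Φ Y)
    (smul : ∀ (φ : M → ℝ) X, SmoothFunNear I φ p → SmoothNear X p →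
      Φ (fun q => φ q • X q) = φ p • Φ X) :
    ∃ L : TangentSpace I p →ₗ[ℝ] A, ∀ X, SmoothNear X p → Φ X = L (X p) := by
  -- The extension by constant coordinates is linear in the vector as a germ at `p`, which makes
  -- this map linear.
  let L : TangentSpace I p →ₗ[ℝ] A :=
    { toFun := fun w => Φ (fieldExtend w)
      map_add' := fun v w => by
        rw [← add _ _ (smoothNear_fieldExtend v) (smoothNear_fieldExtend w)]
        refine congr _ _ (smoothNear_fieldExtend _) ?_
        filter_upwards [eventually_fieldExtend v, eventually_fieldExtend w,
          eventually_fieldExtend (v + w)] with z h₁ h₂ h₃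
        rw [h₃.2, h₁.2, h₂.2, map_add, map_add]
      map_smul' := fun a w => by
        rw [RingHom.id_apply,
          ← smul (fun _ => a) _ (SmoothFunNear.const a) (smoothNear_fieldExtend w)]
        refine congr _ _ (smoothNear_fieldExtend _) ?_
        filter_upwards [eventually_fieldExtend w, eventually_fieldExtend (a • w)] with z h₁ h₂
        rw [h₂.2, h₁.2, map_smul, map_smul] }
  have hL : ∀ w, L w = Φ (fieldExtend w) := fun w => rfl
  refine ⟨L, fun X hX => ?_⟩
  refine SmoothAlongNear.induction_extend (f := id) contMDiff_id (fun X => Φ X = L (X p))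
    ?_ ?_ ?_ ?_ (smoothNear_iff_along.1 hX)
  · intro X Y hX he h
    rw [← congr X Y hX he, h, he.self_of_nhds]
  · intro X Y hX hY h₁ h₂
    exact (add X Y hX hY).trans (by rw [h₁, h₂]; exact (L.map_add _ _).symm)
  · intro φ X hφ hX h
    exact (smul φ X hφ hX).trans (by rw [h]; exact (L.map_smul _ _).symm)
  · intro w
    change Φ (fieldExtend w) = L (fieldExtend w p)
    rw [hL]
    exact congrArg (fun v => Φ (fieldExtend v)) (fieldExtend_self w).symm

/-! ### Lie brackets -/

instance isManifold_minSmoothness_three : IsManifold I (minSmoothness ℝ 3) M := by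
  rw [minSmoothness_of_isRCLikeNormedField]
  exact IsManifold.of_le (n := ∞) ENat.LEInfty.out

section bracket

variable [FiniteDimensional ℝ E] {X Y Z : ∀ p : M, TangentSpace I p} {p : M} {φ : M → ℝ}

theorem SmoothNear.mlieBracket (hX : SmoothNear X p) (hY : SmoothNear Y p) :
    SmoothNear (VectorField.mlieBracket I X Y) p := by
  have := FiniteDimensional.complete ℝ E
  have : IsManifold I (((⊤ : ℕ∞) : WithTop ℕ∞) + 1) M := by simpa using (inferInstance : IsManifold I ∞ M)
  filter_upwards [hX, hY] with q h₁ h₂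
  exact ContMDiffAt.mlieBracket_vectorField (m := ⊤) (n := ⊤) h₁ h₂ (by simp)

theorem mlieBracket_fun_smul (hφ : SmoothFunNear I φ p) (hZ : SmoothNear Z p) :
    VectorField.mlieBracket I X (fun q => φ q • Z q) p =
      mvfderiv I φ p (X p) • Z p + φ p • VectorField.mlieBracket I X Z p := by
  have := FiniteDimensional.complete ℝ E
  exact VectorField.mlieBracket_smul_right hφ.diff hZ.diff

theorem mlieBracket_fun_add (hY : SmoothNear Y p) (hZ : SmoothNear Z p) :
    VectorField.mlieBracket I X (fun q => Y q + Z q) p =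
      VectorField.mlieBracket I X Y p + VectorField.mlieBracket I X Z p := by
  have := FiniteDimensional.complete ℝ E
  exact VectorField.mlieBracket_add_right hY.diff hZ.diff

theorem mlieBracket_jacobi (hX : SmoothNear X p) (hY : SmoothNear Y p) (hZ : SmoothNear Z p) :
    VectorField.mlieBracket I X (VectorField.mlieBracket I Y Z) p =
      VectorField.mlieBracket I (VectorField.mlieBracket I X Y) Z p +
        VectorField.mlieBracket I Y (VectorField.mlieBracket I X Z) p := by
  have := FiniteDimensional.complete ℝ E
  have hle : minSmoothness ℝ 2 ≤ (∞ : WithTop ℕ∞) := by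
    rw [minSmoothness_of_isRCLikeNormedField]; exact ENat.LEInfty.out
  exact VectorField.leibniz_identity_mlieBracket_apply (ContMDiffAt.of_le hX.self hle)
    (ContMDiffAt.of_le hY.self hle) (ContMDiffAt.of_le hZ.self hle)

/-- The Lie bracket is the commutator of derivations. -/
theorem mvfderiv_mlieBracket (hX : SmoothNear X p) (hY : SmoothNear Y p)
    (hφ : SmoothFunNear I φ p) :
    mvfderiv I φ p (VectorField.mlieBracket I X Y p) =
      mvfderiv I (fun q => mvfderiv I φ q (Y q)) p (X p) -
        mvfderiv I (fun q => mvfderiv I φ q (X q)) p (Y p) := by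
  rcases subsingleton_or_nontrivial E with hE | hE
  · have h0 : ∀ v : TangentSpace I p, v = 0 := fun v => hE.elim _ _
    rw [h0 (X p), h0 (Y p), h0 (VectorField.mlieBracket I X Y p)]
    simp
  -- An auxiliary field with Z p ≠ 0: in the Jacobi identity for X, Y, φZ, the Jacobi identity for
  -- X, Y, Z and the first-derivative terms cancel, leaving the claim multiplied by Z p.
  obtain ⟨z, hz⟩ : ∃ z : TangentSpace I p, z ≠ 0 := exists_ne (0 : E)
  set Z : ∀ q : M, TangentSpace I q := fieldExtend z
  have hZ : SmoothNear Z p := smoothNear_fieldExtend z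
  have hZp : Z p = z := fieldExtend_self z
  have key : ∀ U V : ∀ q : M, TangentSpace I q, SmoothNear U p → SmoothNear V p →
      VectorField.mlieBracket I U (VectorField.mlieBracket I V (fun q => φ q • Z q)) p =
      mvfderiv I (fun q => mvfderiv I φ q (V q)) p (U p) • z +
        mvfderiv I φ p (V p) • VectorField.mlieBracket I U Z p +
        (mvfderiv I φ p (U p) • VectorField.mlieBracket I V Z p +
          φ p • VectorField.mlieBracket I U (VectorField.mlieBracket I V Z) p) := by
    intro U V hU hV
    have he : VectorField.mlieBracket I V (fun q => φ q • Z q) =ᶠ[𝓝 p] fun q =>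
        mvfderiv I φ q (V q) • Z q + φ q • VectorField.mlieBracket I V Z q := by
      filter_upwards [hφ.eventually, hZ.eventually] with q a b
      exact mlieBracket_fun_smul a b
    have he' := Filter.EventuallyEq.mlieBracket_vectorField_eq (I := I)
      (Filter.EventuallyEq.refl (𝓝 p) U) he
    rw [he', mlieBracket_fun_add (SmoothNear.smul (hφ.mvfderiv_apply hV) hZ)
        (SmoothNear.smul hφ (hV.mlieBracket hZ)),
      mlieBracket_fun_smul (hφ.mvfderiv_apply hV) hZ, mlieBracket_fun_smul hφ (hV.mlieBracket hZ),
      hZp]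
  have h := mlieBracket_jacobi hX hY (SmoothNear.smul hφ hZ)
  rw [key X Y hX hY, key Y X hY hX, mlieBracket_fun_smul hφ hZ, mlieBracket_jacobi hX hY hZ,
    hZp] at h
  have h2 : (mvfderiv I φ p (VectorField.mlieBracket I X Y p) -
      (mvfderiv I (fun q => mvfderiv I φ q (Y q)) p (X p) -
        mvfderiv I (fun q => mvfderiv I φ q (X q)) p (Y p))) • z = 0 := by
    rw [← sub_eq_zero] at h
    rw [← neg_eq_zero, ← h]
    module
  rcases smul_eq_zero.1 h2 with h3 | h3
  · linarith
  · exact absurd h3 hz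

end bracket

/-! ### Second covariant derivatives -/

theorem connection_congr (cov : Connection I M) {X Y : ∀ q : M, TangentSpace I q} {p : M}
    (hX : SmoothNear X p) (h : ∀ᶠ q in 𝓝 p, X q = Y q) : cov X p = cov Y p :=
  cov.isCovariantDerivativeOnUniv.congr_of_eventuallyEq hX.diff
    (MDifferentiableAt.congr_of_eventuallyEq hX.diff
      (by filter_upwards [h] with q hq; rw [hq])) Filter.univ_mem h

theorem connection_add (cov : Connection I M) {X Y : ∀ q : M, TangentSpace I q} {p : M}
    (hX : SmoothNear X p) (hY : SmoothNear Y p) (u : TangentSpace I p) :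
    cov (fun q => X q + Y q) p u = cov X p u + cov Y p u := by
  rw [← add_apply, ← cov.isCovariantDerivativeOnUniv.add hX.diff hY.diff]
  rfl

theorem connection_smul (cov : Connection I M) {φ : M → ℝ} {X : ∀ q : M, TangentSpace I q} {p : M}
    (hφ : SmoothFunNear I φ p) (hX : SmoothNear X p) (u : TangentSpace I p) :
    cov (fun q => φ q • X q) p u = φ p • cov X p u + mvfderiv I φ p u • X p := by
  have := cov.isCovariantDerivativeOnUniv.leibniz hX.diff hφ.diff
  exact (DFunLike.congr_fun this u).trans (by
    simp [add_apply, _root_.smul_apply, ContinuousLinearMap.smulRight_apply])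

theorem mvfderiv_fun_add_apply {φ ψ : M → ℝ} {p : M} (hφ : SmoothFunNear I φ p)
    (hψ : SmoothFunNear I ψ p) (u : TangentSpace I p) :
    mvfderiv I (fun q => φ q + ψ q) p u = mvfderiv I φ p u + mvfderiv I ψ p u := by
  rw [← add_apply, ← mvfderiv_add hφ.diff hψ.diff]
  rfl

theorem mvfderiv_fun_mul_apply {φ ψ : M → ℝ} {p : M} (hφ : SmoothFunNear I φ p)
    (hψ : SmoothFunNear I ψ p) (u : TangentSpace I p) :
    mvfderiv I (fun q => φ q * ψ q) p u = φ p * mvfderiv I ψ p u + ψ p * mvfderiv I φ p u := by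
  have := DFunLike.congr_fun (mvfderiv_mul hφ.diff hψ.diff) u
  exact this.trans (by simp [add_apply, _root_.smul_apply])

theorem mvfderiv_congr_apply {φ ψ : M → ℝ} {p : M} (h : ∀ᶠ q in 𝓝 p, φ q = ψ q)
    (u : TangentSpace I p) : mvfderiv I φ p u = mvfderiv I ψ p u :=
  DFunLike.congr_fun (mvfderiv_congr h) u

/-- The second covariant derivative of a function. -/
def secondFun (cov : Connection I M) (φ : M → ℝ) (p : M) (u w : TangentSpace I p) : ℝ :=
  mvfderiv I (fun q => mvfderiv I φ q (fieldExtend w q)) p u -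
    mvfderiv I φ p (cov (fieldExtend w) p u)

/-- The second covariant derivative of a vector field. -/
def secondCov (cov : Connection I M) (Z : ∀ q : M, TangentSpace I q) (p : M)
    (u w : TangentSpace I p) : TangentSpace I p :=
  cov (fun q => cov Z q (fieldExtend w q)) p u - cov Z p (cov (fieldExtend w) p u)

section second

variable [FiniteDimensional ℝ E] {g : Metric I M} {cov : Connection I M} {p : M} {φ : M → ℝ}
  {X Y Z : ∀ q : M, TangentSpace I q}

/-- Replacing Y by ψY creates the term (uψ)(Yφ) in both summands, and the two copies cancel; the
expression is tensorial in Y. -/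
theorem exists_linear_secondFun (cov : Connection I M) (hφ : SmoothFunNear I φ p)
    (u : TangentSpace I p) :
    ∃ L : TangentSpace I p →ₗ[ℝ] ℝ, ∀ Y, SmoothNear Y p →
      mvfderiv I (fun q => mvfderiv I φ q (Y q)) p u - mvfderiv I φ p (cov Y p u) = L (Y p) := by
  refine exists_linear_of_tensorial (fun Y => mvfderiv I (fun q => mvfderiv I φ q (Y q)) p u -
    mvfderiv I φ p (cov Y p u)) ?_ ?_ ?_
  · intro X Y hX h
    rw [connection_congr cov hX h]
    congr 1
    refine mvfderiv_congr_apply ?_ u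
    filter_upwards [h] with q hq using by rw [hq]
  · intro X Y hX hY
    rw [connection_add cov hX hY]
    simp only [map_add]
    rw [mvfderiv_fun_add_apply (hφ.mvfderiv_apply hX) (hφ.mvfderiv_apply hY)]
    ring
  · intro ψ X hψ hX
    rw [connection_smul cov hψ hX]
    simp only [map_smul, map_add, smul_eq_mul]
    rw [mvfderiv_fun_mul_apply hψ (hφ.mvfderiv_apply hX)]
    ring

/-- The skew part is [U,W]φ - (∇_U W - ∇_W U)φ, which is zero for a torsion-free connection. -/
theorem secondFun_symm (hcov : IsLeviCivita g cov) (hφ : SmoothFunNear I φ p)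
    (u w : TangentSpace I p) : secondFun cov φ p u w = secondFun cov φ p w u := by
  have hu := smoothNear_fieldExtend u
  have hw := smoothNear_fieldExtend w
  have h₁ := hcov.torsion_free _ _ p hu.diff hw.diff
  have h₂ := mvfderiv_mlieBracket hu hw hφ
  rw [← h₁, map_sub] at h₂
  simp only [fieldExtend_self] at h₂
  unfold secondFun
  linarith

/-- The same cancellation of Leibniz terms as for functions. It permits ∇²Z to be evaluated on
vectors instead of fields. -/
theorem exists_linear_secondCov (hcov : IsLeviCivita g cov) (hZ : SmoothNear Z p)
    (u : TangentSpace I p) :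
    ∃ L : TangentSpace I p →ₗ[ℝ] TangentSpace I p, ∀ Y, SmoothNear Y p →
      cov (fun q => cov Z q (Y q)) p u - cov Z p (cov Y p u) = L (Y p) := by
  refine exists_linear_of_tensorial (fun Y => cov (fun q => cov Z q (Y q)) p u -
    cov Z p (cov Y p u)) ?_ ?_ ?_
  · intro X Y hX h
    rw [connection_congr cov hX h, connection_congr cov (hZ.connection_apply_id hcov hX)]
    filter_upwards [h] with q hq using by rw [hq]
  · intro X Y hX hY
    rw [connection_add cov hX hY]
    simp only [map_add]
    rw [connection_add cov (hZ.connection_apply_id hcov hX) (hZ.connection_apply_id hcov hY)]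
    abel
  · intro ψ X hψ hX
    rw [connection_smul cov hψ hX]
    simp only [map_smul, map_add]
    rw [connection_smul cov hψ (hZ.connection_apply_id hcov hX)]
    module

theorem secondCov_eq (hcov : IsLeviCivita g cov) (hZ : SmoothNear Z p) (hY : SmoothNear Y p)
    (u : TangentSpace I p) :
    cov (fun q => cov Z q (Y q)) p u =
      secondCov cov Z p u (Y p) + cov Z p (cov Y p u) := by
  obtain ⟨L, hL⟩ := exists_linear_secondCov hcov hZ u
  have h₁ := hL Y hY
  have h₂ := hL _ (smoothNear_fieldExtend (Y p))
  rw [fieldExtend_self] at h₂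
  rw [secondCov, h₂, ← h₁]
  abel

theorem secondCov_add_right (hcov : IsLeviCivita g cov) (hZ : SmoothNear Z p)
    (u w₁ w₂ : TangentSpace I p) :
    secondCov cov Z p u (w₁ + w₂) = secondCov cov Z p u w₁ + secondCov cov Z p u w₂ := by
  obtain ⟨L, hL⟩ := exists_linear_secondCov hcov hZ u
  simp only [secondCov, hL _ (smoothNear_fieldExtend _), fieldExtend_self, map_add]

theorem secondCov_smul_right (hcov : IsLeviCivita g cov) (hZ : SmoothNear Z p)
    (u w : TangentSpace I p) (a : ℝ) :
    secondCov cov Z p u (a • w) = a • secondCov cov Z p u w := by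
  obtain ⟨L, hL⟩ := exists_linear_secondCov hcov hZ u
  simp only [secondCov, hL _ (smoothNear_fieldExtend _), fieldExtend_self, map_smul]

theorem secondCov_add_left (cov : Connection I M) (u₁ u₂ w : TangentSpace I p) :
    secondCov cov Z p (u₁ + u₂) w = secondCov cov Z p u₁ w + secondCov cov Z p u₂ w := by
  simp only [secondCov, map_add]
  abel

theorem secondCov_smul_left (cov : Connection I M) (u w : TangentSpace I p) (a : ℝ) :
    secondCov cov Z p (a • u) w = a • secondCov cov Z p u w := by
  simp only [secondCov, map_smul, smul_sub]

end second

/-! ### Second derivatives along a map, and torsion-freeness -/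

section secondAlong

variable [FiniteDimensional ℝ E'] {g' : Metric I' M'} {cov' : Connection I' M'} {f : M → M'}
  {p : M} {W : ∀ q : M, TangentSpace I' (f q)}

theorem mvfderiv_apply_along {φ : M' → ℝ} (hf : ContMDiff I I' ∞ f)
    (hφ : SmoothFunNear I' φ (f p)) (hW : SmoothAlongNear I f W p) :
    SmoothFunNear I (fun q => mvfderiv I' φ (f q) (W q)) p := by
  refine SmoothAlongNear.induction hf
    (fun W => SmoothFunNear I (fun q => mvfderiv I' φ (f q) (W q)) p) ?_ ?_ ?_ ?_ hW
  · intro W₁ W₂ _ he h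
    refine h.congr ?_
    filter_upwards [he] with q hq using by rw [hq]
  · intro W₁ W₂ _ _ h₁ h₂
    simp only [map_add]
    filter_upwards [h₁, h₂] with q a b using a.add b
  · intro ψ W hψ _ h
    simp only [map_smul, smul_eq_mul]
    filter_upwards [hψ, h] with q a b using a.mul b
  · intro Z hZ
    exact SmoothFunNear.comp hf (hφ.mvfderiv_apply hZ)

/-- The chain rule for second derivatives: a Hessian term, tensorial in `W`, plus the first
derivative in the direction D_v W. Its role is to prove `covAlong_torsion_free`, where the symmetric
Hessian terms cancel. -/
theorem mvfderiv_mvfderiv_along (cov' : Connection I' M') {φ : M' → ℝ} (hf : ContMDiff I I' ∞ f)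
    (hφ : SmoothFunNear I' φ (f p)) (hW : SmoothAlongNear I f W p) (v : TangentSpace I p) :
    mvfderiv I (fun q => mvfderiv I' φ (f q) (W q)) p v =
      secondFun cov' φ (f p) (mfderiv I I' f p v) (W p) +
        mvfderiv I' φ (f p) (covAlong I cov' f W p v) := by
  have hfd : MDifferentiableAt I I' f p := (hf p).mdifferentiableAt (by simp)
  obtain ⟨L, hL⟩ := exists_linear_secondFun cov' hφ (mfderiv I I' f p v)
  have hL' : ∀ w, secondFun cov' φ (f p) (mfderiv I I' f p v) w = L w := by
    intro w
    rw [secondFun, hL _ (smoothNear_fieldExtend w), fieldExtend_self]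
  rw [hL']
  refine SmoothAlongNear.induction hf
    (fun W => mvfderiv I (fun q => mvfderiv I' φ (f q) (W q)) p v =
      L (W p) + mvfderiv I' φ (f p) (covAlong I cov' f W p v)) ?_ ?_ ?_ ?_ hW
  · intro W₁ W₂ _ he h
    rw [← covAlong_congr he, ← he.self_of_nhds, ← h]
    refine mvfderiv_congr_apply ?_ v
    filter_upwards [he] with q hq using by rw [hq]
  · intro W₁ W₂ h₁ h₂ e₁ e₂
    rw [covAlong_add h₁.diff h₂.diff]
    simp only [map_add]
    rw [mvfderiv_fun_add_apply (mvfderiv_apply_along hf hφ h₁) (mvfderiv_apply_along hf hφ h₂),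
      e₁, e₂]
    ring
  · intro ψ W hψ h₁ e₁
    rw [covAlong_smul hψ.diff h₁.diff]
    simp only [map_add, map_smul, smul_eq_mul]
    rw [mvfderiv_fun_mul_apply hψ (mvfderiv_apply_along hf hφ h₁), e₁]
    ring
  · intro Z hZ
    rw [covAlong_comp hfd hZ.diff, ← hL Z hZ]
    have := mvfderiv_comp_apply p (hφ.mvfderiv_apply hZ).diff hfd v
    refine this.trans ?_
    ring

/-- The analogue for ∇'Z in place of dφ. It differentiates ∇'_W Z along `f`, as needed for the Ricci
identity and for the second derivative of the angle function. -/
theorem covAlong_connection_apply (hcov' : IsLeviCivita g' cov') (hf : ContMDiff I I' ∞ f)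
    {Z : ∀ y : M', TangentSpace I' y}
    (hZ : SmoothNear Z (f p)) (hW : SmoothAlongNear I f W p) (v : TangentSpace I p) :
    covAlong I cov' f (fun q => cov' Z (f q) (W q)) p v =
      secondCov cov' Z (f p) (mfderiv I I' f p v) (W p) +
        cov' Z (f p) (covAlong I cov' f W p v) := by
  have hfd : MDifferentiableAt I I' f p := (hf p).mdifferentiableAt (by simp)
  refine SmoothAlongNear.induction hf
    (fun W => covAlong I cov' f (fun q => cov' Z (f q) (W q)) p v =
      secondCov cov' Z (f p) (mfderiv I I' f p v) (W p) +
        cov' Z (f p) (covAlong I cov' f W p v)) ?_ ?_ ?_ ?_ hW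
  · intro W₁ W₂ _ he h
    rw [← covAlong_congr he, ← he.self_of_nhds, ← h]
    refine DFunLike.congr_fun (covAlong_congr ?_) v
    filter_upwards [he] with q hq using by rw [hq]
  · intro W₁ W₂ h₁ h₂ e₁ e₂
    rw [covAlong_add h₁.diff h₂.diff, secondCov_add_right hcov' hZ]
    simp only [map_add]
    rw [covAlong_add (hZ.connection_apply hcov' hf h₁).diff
      (hZ.connection_apply hcov' hf h₂).diff, e₁, e₂]
    abel
  · intro ψ W hψ h₁ e₁
    rw [covAlong_smul hψ.diff h₁.diff, secondCov_smul_right hcov' hZ]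
    simp only [map_add, map_smul]
    rw [covAlong_smul hψ.diff (hZ.connection_apply hcov' hf h₁).diff, e₁]
    module
  · intro Y hY
    rw [covAlong_comp hfd hY.diff,
      covAlong_comp (Z := fun y => cov' Z y (Y y)) hfd (hZ.connection_apply_id hcov' hY).diff,
      secondCov_eq hcov' hZ hY]

/-- Smooth functions separate tangent vectors. -/
theorem exists_smoothFunNear_mvfderiv_ne_zero {y : M'} {w : TangentSpace I' y} (hw : w ≠ 0) :
    ∃ φ : M' → ℝ, SmoothFunNear I' φ y ∧ mvfderiv I' φ y w ≠ 0 := by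
  have hinv : (mfderiv I' 𝓘(ℝ, E') (extChartAt I' y) y).IsInvertible :=
    isInvertible_mfderiv_extChartAt (mem_extChartAt_source (I := I') y)
  have hne : mfderiv I' 𝓘(ℝ, E') (extChartAt I' y) y w ≠ 0 := by
    intro h
    exact hw (hinv.injective (h.trans (map_zero _).symm))
  obtain ⟨ℓ, hℓ⟩ : ∃ ℓ : E' →L[ℝ] ℝ,
      ℓ (mfderiv I' 𝓘(ℝ, E') (extChartAt I' y) y w) ≠ 0 :=
    SeparatingDual.exists_ne_zero (R := ℝ) (V := E') hne
  have hs : ∀ᶠ z in 𝓝 y, ContMDiffAt I' 𝓘(ℝ, E') ∞ (extChartAt I' y) z := by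
    filter_upwards [(chartAt H' y).open_source.mem_nhds (mem_chart_source H' y)] with z hz
    exact contMDiffAt_extChartAt' hz
  refine ⟨fun z => ℓ (extChartAt I' y z), ?_, ?_⟩
  · filter_upwards [hs] with z hz using ℓ.contMDiff.contMDiffAt.comp z hz
  · have := mvfderiv_comp_apply y (ℓ.contMDiff.mdifferentiableAt (n := ∞) (by simp))
      (hs.self_of_nhds.mdifferentiableAt (by simp)) w
    rw [show mvfderiv I' (fun z => ℓ (extChartAt I' y z)) y w = _ from this]
    rw [mvfderiv, ContinuousLinearMap.mfderiv_eq]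
    exact hℓ

/-- The covariant derivative along a map is torsion free. -/
theorem covAlong_torsion_free (hcov' : IsLeviCivita g' cov') [FiniteDimensional ℝ E]
    (hf : ContMDiff I I' ∞ f) {X Y : ∀ q : M, TangentSpace I q}
    (hX : SmoothNear X p) (hY : SmoothNear Y p) :
    covAlong I cov' f (fun q => mfderiv I I' f q (Y q)) p (X p) -
      covAlong I cov' f (fun q => mfderiv I I' f q (X q)) p (Y p) =
        mfderiv I I' f p (VectorField.mlieBracket I X Y p) := by
  have hfd : ∀ q, MDifferentiableAt I I' f q := fun q => (hf q).mdifferentiableAt (by simp)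
  -- Functions separate vectors, so it suffices to apply both sides to a function φ. There the
  -- second derivatives give [X,Y](φ ∘ f), and the ambient Hessian terms cancel by symmetry.
  by_contra hne
  obtain ⟨φ, hφ, h⟩ := exists_smoothFunNear_mvfderiv_ne_zero (sub_ne_zero.2 hne)
  apply h
  have hφf : SmoothFunNear I (fun q => φ (f q)) p := hφ.comp hf
  have hcomp : ∀ U : ∀ q : M, TangentSpace I q, ∀ᶠ q in 𝓝 p,
      mvfderiv I (fun q => φ (f q)) q (U q) = mvfderiv I' φ (f q) (mfderiv I I' f q (U q)) := by
    intro U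
    filter_upwards [hf.continuous.continuousAt.eventually hφ.eventually] with q hq
    exact mvfderiv_comp_apply q hq.diff (hfd q) (U q)
  have h₁ := mvfderiv_mlieBracket hX hY hφf
  rw [mvfderiv_congr_apply (hcomp X), mvfderiv_congr_apply (hcomp Y),
    mvfderiv_mvfderiv_along cov' hf hφ (hX.mfderiv_apply hf),
    mvfderiv_mvfderiv_along cov' hf hφ (hY.mfderiv_apply hf),
    (hcomp (VectorField.mlieBracket I X Y)).self_of_nhds, secondFun_symm hcov' hφ] at h₁
  simp only [map_sub]
  linarith

end secondAlong

/-! ### Algebraic curvature tensors -/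

/-- The symmetries of a Riemann curvature tensor. -/
structure IsCurvatureLike {V : Type*} [AddCommGroup V] [Module ℝ V] (T : V → V → V → V → ℝ) :
    Prop where
  add (u u' v w z : V) : T (u + u') v w z = T u v w z + T u' v w z
  smul (a : ℝ) (u v w z : V) : T (a • u) v w z = a * T u v w z
  antisymm_left (u v w z : V) : T u v w z = -T v u w z
  antisymm_right (u v w z : V) : T u v w z = -T u v z w
  bianchi (u v w z : V) : T u v w z + T v w u z + T w u v z = 0

/-- The product of the two polynomials vanishes at every real number, and ℝ[X] is an integral
domain, so the second factor is zero. This carries an identity from nondegenerate planes to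
degenerate ones. -/
theorem eq_zero_of_quadratic {a b c d e h : ℝ} (ha : a ≠ 0)
    (H : ∀ t : ℝ, a * t ^ 2 + b * t + c ≠ 0 → d * t ^ 2 + e * t + h = 0) : h = 0 := by
  open Polynomial in
  have hP : (C a * X ^ 2 + C b * X + C c : ℝ[X]) ≠ 0 := by
    intro h0
    have := congrArg (fun P => P.coeff 2) h0
    simp at this
    exact ha this
  have hmul : (C a * X ^ 2 + C b * X + C c : ℝ[X]) * (C d * X ^ 2 + C e * X + C h) = 0 := by
    refine Polynomial.funext fun t => ?_
    simp only [eval_mul, eval_add, eval_C, eval_pow, eval_X, eval_zero]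
    by_cases ht : a * t ^ 2 + b * t + c = 0
    · rw [ht, zero_mul]
    · rw [H t ht, mul_zero]
  have h0 := (mul_eq_zero.1 hmul).resolve_left hP
  simpa using congrArg (Polynomial.eval 0) h0

namespace IsCurvatureLike

variable {V : Type*} [AddCommGroup V] [Module ℝ V] {T : V → V → V → V → ℝ}

/-- The classical octahedron argument: four Bianchi identities, one for each omitted vector,
combined through the two skew symmetries. -/
theorem pair_symm (h : IsCurvatureLike T) (u v w z : V) : T u v w z = T w z u v := by
  have h₁ := h.bianchi u v w z
  have h₂ := h.bianchi v w z u
  have h₃ := h.bianchi w z u v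
  have h₄ := h.bianchi z u v w
  have a := h.antisymm_left
  have b := h.antisymm_right
  linarith [b v w u z, a w u v z, b w u v z, b z v w u, a z v w u, b w z v u, a z w v u, b u w z v,
    a u w z v, b z u w v, b u v z w, a v z u w, b v z u w, a v z w u, b w u z v, a w u z v]

theorem add₄ (h : IsCurvatureLike T) (u v w z z' : V) :
    T u v w (z + z') = T u v w z + T u v w z' := by
  rw [h.antisymm_right, h.pair_symm, h.add, h.antisymm_right u v w z, h.antisymm_right u v w z',
    h.pair_symm u v z w, h.pair_symm u v z' w]
  ring

theorem smul₄ (h : IsCurvatureLike T) (a : ℝ) (u v w z : V) :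
    T u v w (a • z) = a * T u v w z := by
  rw [h.antisymm_right, h.pair_symm, h.smul, h.antisymm_right u v w z, h.pair_symm u v z w]
  ring

theorem add₂ (h : IsCurvatureLike T) (u v v' w z : V) :
    T u (v + v') w z = T u v w z + T u v' w z := by
  rw [h.antisymm_left, h.add, h.antisymm_left u v, h.antisymm_left u v']
  ring

theorem add₃ (h : IsCurvatureLike T) (u v w w' z : V) :
    T u v (w + w') z = T u v w z + T u v w' z := by
  rw [h.antisymm_right, h.add₄, h.antisymm_right u v w, h.antisymm_right u v w']
  ring

/-- A curvature tensor with vanishing sectional curvatures vanishes. -/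
theorem eq_zero (h : IsCurvatureLike T) (h0 : ∀ u v, T u v v u = 0) (u v w z : V) :
    T u v w z = 0 := by
  have h₁ : ∀ u v z, T u v v z = 0 := by
    intro u v z
    have e := h0 (u + z) v
    rw [h.add, h.add₄, h.add₄, h0, h0] at e
    have e₂ : T z v v u = T u v v z := by
      rw [h.pair_symm, h.antisymm_left, h.antisymm_right, neg_neg]
    linarith
  have h₂ : ∀ u v w z, T u v w z = -T u w v z := by
    intro u v w z
    have e := h₁ u (v + w) z
    rw [h.add₂, h.add₃, h.add₃, h₁, h₁] at e
    linarith
  have a := h.antisymm_left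
  -- Skew symmetry in the first pair and in the middle pair makes T invariant under cyclic
  -- permutation of the first three slots, so Bianchi reads 3T = 0.
  linarith [h.bianchi u v w z, a u v w z, h₂ v u w z, a v w u z, h₂ w v u z]

theorem sub (h : IsCurvatureLike T) {S : V → V → V → V → ℝ} (hS : IsCurvatureLike S) (c : ℝ) :
    IsCurvatureLike (fun u v w z => T u v w z - c * S u v w z) where
  add u u' v w z := by rw [h.add, hS.add]; ring
  smul a u v w z := by rw [h.smul, hS.smul]; ring
  antisymm_left u v w z := by rw [h.antisymm_left, hS.antisymm_left]; ring
  antisymm_right u v w z := by rw [h.antisymm_right, hS.antisymm_right]; ring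
  bianchi u v w z := by linear_combination h.bianchi u v w z - c * hS.bianchi u v w z

/-- The curvature tensor of the unit sphere. -/
theorem of_bilin (B : V →ₗ[ℝ] V →ₗ[ℝ] ℝ) (hB : ∀ u v, B u v = B v u) :
    IsCurvatureLike (fun u v w z => B v w * B u z - B u w * B v z) where
  add u u' v w z := by simp only [map_add, LinearMap.add_apply]; ring
  smul a u v w z := by simp only [map_smul, LinearMap.smul_apply, smul_eq_mul]; ring
  antisymm_left u v w z := by ring
  antisymm_right u v w z := by ring
  bianchi u v w z := by rw [hB w u, hB w v, hB v u]; ring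

/-- Along a line u + s u' the Gram determinant S is a quadratic polynomial in s with nonzero leading
coefficient, so vanishing of T wherever S ≠ 0 extends to s = 0. One nondegenerate plane thus
suffices: one application frees the first vector of the plane, a further one the second. -/
theorem apply_self_of_gram_ne_zero (h : IsCurvatureLike T) {S : V → V → V → V → ℝ}
    (hS : IsCurvatureLike S) (H : ∀ u v, S u v v u ≠ 0 → T u v v u = 0) {u' v' : V}
    (hne : S u' v' v' u' ≠ 0) (u v : V) : T u v v u = 0 := by
  have expand : ∀ {R : V → V → V → V → ℝ}, IsCurvatureLike R → ∀ (u u' x : V) (s : ℝ),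
      R (u + s • u') x x (u + s • u') =
        R u' x x u' * s ^ 2 + (R u x x u' + R u' x x u) * s + R u x x u := by
    intro R hR u u' x s
    rw [hR.add, hR.add₄, hR.add₄, hR.smul, hR.smul, hR.smul₄, hR.smul₄]
    ring
  have swap : ∀ {R : V → V → V → V → ℝ}, IsCurvatureLike R → ∀ u v : V,
      R u v v u = R v u u v := by
    intro R hR u v
    rw [hR.antisymm_left, hR.antisymm_right, neg_neg]
  have step : ∀ {u' x : V}, S u' x x u' ≠ 0 → ∀ u, T u x x u = 0 := by
    intro u' x hx u
    refine eq_zero_of_quadratic (b := S u x x u' + S u' x x u) (c := S u x x u) (d := T u' x x u')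
      (e := T u x x u' + T u' x x u) hx fun s hs => ?_
    rw [← expand hS] at hs
    rw [← expand h]
    exact H _ _ hs
  rw [swap hS] at hne
  rw [swap h]
  refine eq_zero_of_quadratic (b := S v u' u' v' + S v' u' u' v) (c := S v u' u' v)
    (d := T v' u u v') (e := T v u u v' + T v' u u v) hne fun s hs => ?_
  -- For these s the vector v + s v' spans a nondegenerate plane with u', so `step` permits any u in
  -- place of u'.
  rw [← expand hS] at hs
  rw [← expand h, ← swap h]
  rw [swap hS] at hs
  exact step hs u

/-- A curvature tensor with constant sectional curvatures. -/
theorem eq_of_const (h : IsCurvatureLike T) (B : V →ₗ[ℝ] V →ₗ[ℝ] ℝ) (hB : ∀ u v, B u v = B v u)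
    (hnd : ∀ v, (∀ w, B v w = 0) → v = 0) (c : ℝ)
    (H : ∀ u v, B u u * B v v - B u v ^ 2 ≠ 0 →
      T u v v u = c * (B u u * B v v - B u v ^ 2)) (u v w z : V) :
    T u v w z = c * (B v w * B u z - B u w * B v z) := by
  have hS := of_bilin B hB
  have hgram : ∀ u v, B v v * B u u - B u v * B v u = B u u * B v v - B u v ^ 2 := by
    intro u v
    rw [hB v u]; ring
  by_cases hne : ∃ u' v', B u' u' * B v' v' - B u' v' ^ 2 ≠ 0
  · obtain ⟨u', v', hne⟩ := hne
    have hTS := h.sub hS c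
    have h0 := hTS.eq_zero (fun u v => hTS.apply_self_of_gram_ne_zero hS (fun u v huv => by
      rw [hgram] at huv ⊢
      rw [H u v huv, sub_self]) (u' := u') (v' := v') (by rw [hgram]; exact hne) u v) u v w z
    exact sub_eq_zero.1 h0
  -- Without nondegenerate planes the hypothesis on T is empty. But then the tensor of the unit
  -- sphere vanishes, so B(v,x)u = B(u,x)v: any two vectors are proportional, and T vanishes by skew
  -- symmetry.
  · push Not at hne
    have h0 := hS.eq_zero (fun u v => by rw [hgram]; exact hne u v)
    have hT : T u v w z = 0 := by
      by_cases hv : v = 0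
      · rw [h.antisymm_left, hv, ← zero_smul ℝ (0 : V), h.smul, zero_mul, neg_zero]
      · have : ∃ x, B v x ≠ 0 := by
          by_contra hx
          push Not at hx
          exact hv (hnd v hx)
        obtain ⟨x, hx⟩ := this
        have hu : B v x • u - B u x • v = 0 := by
          refine hnd _ fun y => ?_
          simpa [LinearMap.sub_apply, LinearMap.smul_apply] using h0 u v x y
        have hvv : T v v w z = 0 := by linarith [h.antisymm_left v v w z]
        have e : B v x * T u v w z = B u x * T v v w z := by
          rw [← h.smul, ← h.smul, sub_eq_zero.1 hu]
        rw [hvv, mul_zero] at e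
        exact (mul_eq_zero.1 e).resolve_left hx
    rw [hT, h0 u v w z, mul_zero]

end IsCurvatureLike

/-! ### Globalization of local fields -/

/-- Multiply by a bump function supported where `X` is smooth; Hausdorffness makes the product
smooth everywhere. It supplies global test fields for the curvature and conformality hypotheses. -/
theorem exists_smoothField_eq [FiniteDimensional ℝ E] [T2Space M] {X : ∀ q : M, TangentSpace I q}
    {p : M} (hX : SmoothNear X p) :
    ∃ X' : ∀ q : M, TangentSpace I q, SmoothField X' ∧ ∀ᶠ q in 𝓝 p, X q = X' q := by
  obtain ⟨U, hU, hUo, hpU⟩ := eventually_nhds_iff.1 hX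
  obtain ⟨ψ, hψ, hψU⟩ :=
    (SmoothBumpFunction.nhds_basis_tsupport (I := I) p).mem_iff.1 (hUo.mem_nhds hpU)
  refine ⟨fun q => ψ q • X q, ?_, ?_⟩
  · exact ContMDiffOn.smul_section_of_tsupport ψ.contMDiff.contMDiffOn hUo hψU
      (fun q hq => (hU q hq).contMDiffWithinAt)
  · filter_upwards [ψ.eventuallyEq_one] with q hq
    rw [hq, Pi.one_apply, one_smul]

/-! ### The Riemann curvature tensor -/

/-- The commutator of second covariant derivatives, `R(u,v)Z`. -/
def curvCov (cov : Connection I M) (Z : ∀ q : M, TangentSpace I q) (p : M)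
    (u v : TangentSpace I p) : TangentSpace I p :=
  secondCov cov Z p u v - secondCov cov Z p v u

section curvature

variable [FiniteDimensional ℝ E] {g : Metric I M} {cov : Connection I M} {p : M} {φ : M → ℝ}
  {X Y Z : ∀ q : M, TangentSpace I q}

/-- Torsion-freeness turns the bracket into ∇_X Y - ∇_Y X, which absorbs the corrections in the two
second covariant derivatives. -/
theorem curvature_eq_curvCov (hcov : IsLeviCivita g cov) (hX : SmoothNear X p)
    (hY : SmoothNear Y p) (hZ : SmoothNear Z p) :
    curvature cov X Y Z p = curvCov cov Z p (X p) (Y p) := by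
  rw [curvature, secondCov_eq hcov hZ hY, secondCov_eq hcov hZ hX,
    ← hcov.torsion_free X Y p hX.diff hY.diff, curvCov, map_sub]
  abel

theorem secondCov_congr (hcov : IsLeviCivita g cov) {Z' : ∀ q : M, TangentSpace I q}
    (hZ : SmoothNear Z p) (h : ∀ᶠ q in 𝓝 p, Z q = Z' q) (u v : TangentSpace I p) :
    secondCov cov Z p u v = secondCov cov Z' p u v := by
  rw [secondCov, secondCov, connection_congr cov hZ h,
    connection_congr cov (hZ.connection_apply_id hcov (smoothNear_fieldExtend v))]
  filter_upwards [hZ.eventually, eventually_eventually_nhds.2 h] with q h₁ h₂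
  rw [connection_congr cov h₁ h₂]

theorem secondCov_add (hcov : IsLeviCivita g cov) (hY : SmoothNear Y p) (hZ : SmoothNear Z p)
    (u v : TangentSpace I p) : secondCov cov (fun q => Y q + Z q) p u v =
      secondCov cov Y p u v + secondCov cov Z p u v := by
  have hv := smoothNear_fieldExtend v
  have he : ∀ᶠ q in 𝓝 p, cov (fun q => Y q + Z q) q (fieldExtend v q) =
      cov Y q (fieldExtend v q) + cov Z q (fieldExtend v q) := by
    filter_upwards [hY.eventually, hZ.eventually] with q a b
    exact connection_add cov a b _
  rw [secondCov, connection_add cov hY hZ,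
    connection_congr cov ((hY.add hZ).connection_apply_id hcov hv) he,
    connection_add cov (hY.connection_apply_id hcov hv) (hZ.connection_apply_id hcov hv)]
  simp only [secondCov]
  abel

theorem secondCov_smul (hcov : IsLeviCivita g cov) (hφ : SmoothFunNear I φ p)
    (hZ : SmoothNear Z p) (u v : TangentSpace I p) :
    secondCov cov (fun q => φ q • Z q) p u v =
      φ p • secondCov cov Z p u v + mvfderiv I φ p u • cov Z p v + mvfderiv I φ p v • cov Z p u +
        secondFun cov φ p u v • Z p := by
  have hv := smoothNear_fieldExtend v
  have he : ∀ᶠ q in 𝓝 p, cov (fun q => φ q • Z q) q (fieldExtend v q) =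
      φ q • cov Z q (fieldExtend v q) + mvfderiv I φ q (fieldExtend v q) • Z q := by
    filter_upwards [hφ.eventually, hZ.eventually] with q a b
    exact connection_smul cov a b _
  have h₁ := hZ.connection_apply_id hcov hv
  have h₂ := hφ.mvfderiv_apply hv
  rw [secondCov, connection_smul cov hφ hZ,
    connection_congr cov ((SmoothNear.smul hφ hZ).connection_apply_id hcov hv) he,
    connection_add cov (SmoothNear.smul hφ h₁) (SmoothNear.smul h₂ hZ),
    connection_smul cov hφ h₁, connection_smul cov h₂ hZ]
  simp only [secondCov, secondFun, fieldExtend_self]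
  module

/-- The Riemann curvature tensor. -/
def riem (cov : Connection I M) (p : M) (u v z : TangentSpace I p) : TangentSpace I p :=
  curvCov cov (fieldExtend z) p u v

/-- In ∇²(φZ) all terms containing a derivative of φ are symmetric in u, v, the Hessian of φ by
torsion-freeness; they disappear in the commutator. -/
theorem exists_linear_curvCov (hcov : IsLeviCivita g cov) (u v : TangentSpace I p) :
    ∃ L : TangentSpace I p →ₗ[ℝ] TangentSpace I p, ∀ Z, SmoothNear Z p →
      curvCov cov Z p u v = L (Z p) := by
  refine exists_linear_of_tensorial (fun Z => curvCov cov Z p u v) ?_ ?_ ?_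
  · intro X Y hX h
    simp only [curvCov, secondCov_congr hcov hX h]
  · intro X Y hX hY
    simp only [curvCov, secondCov_add hcov hX hY]
    abel
  · intro φ X hφ hX
    simp only [curvCov, secondCov_smul hcov hφ hX, secondFun_symm hcov hφ u v]
    module

theorem curvCov_eq_riem (hcov : IsLeviCivita g cov) (hZ : SmoothNear Z p)
    (u v : TangentSpace I p) : curvCov cov Z p u v = riem cov p u v (Z p) := by
  obtain ⟨L, hL⟩ := exists_linear_curvCov hcov u v
  rw [riem, hL _ hZ, hL _ (smoothNear_fieldExtend _), fieldExtend_self]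

theorem riem_add_right (hcov : IsLeviCivita g cov) (u v z z' : TangentSpace I p) :
    riem cov p u v (z + z') = riem cov p u v z + riem cov p u v z' := by
  obtain ⟨L, hL⟩ := exists_linear_curvCov hcov u v
  simp only [riem, hL _ (smoothNear_fieldExtend _), fieldExtend_self, map_add]

theorem riem_antisymm (cov : Connection I M) (u v z : TangentSpace I p) :
    riem cov p u v z = -riem cov p v u z := by
  simp only [riem, curvCov]
  abel

theorem riem_add_left (hcov : IsLeviCivita g cov) (u u' v z : TangentSpace I p) :
    riem cov p (u + u') v z = riem cov p u v z + riem cov p u' v z := by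
  simp only [riem, curvCov, secondCov_add_left,
    secondCov_add_right hcov (smoothNear_fieldExtend z)]
  abel

theorem riem_smul_left (hcov : IsLeviCivita g cov) (a : ℝ) (u v z : TangentSpace I p) :
    riem cov p (a • u) v z = a • riem cov p u v z := by
  simp only [riem, curvCov, secondCov_smul_left,
    secondCov_smul_right hcov (smoothNear_fieldExtend z), smul_sub]

theorem secondFun_inner_self (hcov : IsLeviCivita g cov) (hZ : SmoothNear Z p)
    (u v : TangentSpace I p) :
    secondFun cov (fun q => g.inner q (Z q) (Z q)) p u v =
      2 * g.inner p (secondCov cov Z p u v) (Z p) +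
        2 * g.inner p (cov Z p v) (cov Z p u) := by
  have hv := smoothNear_fieldExtend v
  have hd : ∀ q (w : TangentSpace I q), SmoothNear Z q →
      mvfderiv I (fun q => g.inner q (Z q) (Z q)) q w = 2 * g.inner q (cov Z q w) (Z q) := by
    intro q w hq
    rw [hcov.compatible Z Z q w hq.diff hq.diff, g.symm q (Z q)]
    ring
  have he : ∀ᶠ q in 𝓝 p, mvfderiv I (fun q => g.inner q (Z q) (Z q)) q (fieldExtend v q) =
      2 * g.inner q (cov Z q (fieldExtend v q)) (Z q) := by
    filter_upwards [hZ.eventually] with q hq using hd q _ hq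
  have h₁ := hZ.connection_apply_id hcov hv
  rw [secondFun, mvfderiv_congr_apply he,
    mvfderiv_fun_mul_apply (SmoothFunNear.const 2) (h₁.inner hZ), hd p _ hZ,
    hcov.compatible _ _ p u h₁.diff hZ.diff]
  simp only [secondCov, fieldExtend_self, map_sub, sub_apply, mvfderiv_const, zero_apply]
  ring

/-- The Hessian of the function g(Z,Z) is symmetric, and so is its term 2g(∇_u Z, ∇_v Z). What is
left of the skew part is 2g(R(u,v)Z, Z). -/
theorem riem_inner_self (hcov : IsLeviCivita g cov) (u v z : TangentSpace I p) :
    g.inner p (riem cov p u v z) z = 0 := by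
  have hz := smoothNear_fieldExtend z
  have h := secondFun_symm hcov (hz.inner (g := g) hz) u v
  rw [secondFun_inner_self hcov hz, secondFun_inner_self hcov hz,
    g.symm p (cov (fieldExtend z) p v)] at h
  have e := fieldExtend_self z
  rw [riem, curvCov, map_sub, sub_apply]
  rw [e] at h
  linarith

theorem riem_bianchi (hcov : IsLeviCivita g cov) (u v w : TangentSpace I p) :
    riem cov p u v w + riem cov p v w u + riem cov p w u v = 0 := by
  have hu := smoothNear_fieldExtend u
  have hv := smoothNear_fieldExtend v
  have hw := smoothNear_fieldExtend w
  -- Torsion-freeness, used twice, leaves only brackets and first derivatives. In the cyclic sum the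
  -- first derivatives cancel the bracket terms of the curvature, and the iterated brackets cancel
  -- by Jacobi.
  have key : ∀ {X Y Z : ∀ q : M, TangentSpace I q}, SmoothNear X p → SmoothNear Y p →
      SmoothNear Z p → cov (fun q => cov Z q (Y q)) p (X p) - cov (fun q => cov Y q (Z q)) p (X p) =
        cov X p (VectorField.mlieBracket I Y Z p) +
          VectorField.mlieBracket I X (VectorField.mlieBracket I Y Z) p := by
    intro X Y Z hX hY hZ
    have hYZ := hY.mlieBracket hZ
    have h₁ := hY.connection_apply_id hcov hZ
    have he : ∀ᶠ q in 𝓝 p, cov Z q (Y q) =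
        cov Y q (Z q) + VectorField.mlieBracket I Y Z q := by
      filter_upwards [hY, hZ] with q a b
      rw [← hcov.torsion_free Y Z q a.diff b.diff]
      abel
    rw [connection_congr cov (hZ.connection_apply_id hcov hY) he, connection_add cov h₁ hYZ,
      ← hcov.torsion_free X _ p hX.diff hYZ.diff]
    abel
  have hr : ∀ {X Y Z : ∀ q : M, TangentSpace I q}, SmoothNear X p → SmoothNear Y p →
      SmoothNear Z p → riem cov p (X p) (Y p) (Z p) = curvature cov X Y Z p := by
    intro X Y Z hX hY hZ
    rw [curvature_eq_curvCov hcov hX hY hZ, curvCov_eq_riem hcov hZ]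
  have h₁ := key hu hv hw
  have h₂ := key hv hw hu
  have h₃ := key hw hu hv
  have j := mlieBracket_jacobi hu hv hw
  rw [VectorField.mlieBracket_swap_apply (V := VectorField.mlieBracket I (fieldExtend u)
    (fieldExtend v))] at j
  have s : VectorField.mlieBracket I (fieldExtend v)
      (VectorField.mlieBracket I (fieldExtend w) (fieldExtend u)) p =
      -VectorField.mlieBracket I (fieldExtend v)
      (VectorField.mlieBracket I (fieldExtend u) (fieldExtend w)) p := by
    rw [VectorField.mlieBracket_swap (V := fieldExtend w)]
    have := FiniteDimensional.complete ℝ E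
    exact (VectorField.mlieBracket_const_smul_right (c := (-1 : ℝ)) (hu.mlieBracket hw).diff
      |> fun h => by simpa using h)
  have r₁ := hr hu hv hw
  have r₂ := hr hv hw hu
  have r₃ := hr hw hu hv
  simp only [fieldExtend_self, curvature] at r₁ r₂ r₃ h₁ h₂ h₃
  rw [s] at h₂
  rw [j] at h₁
  rw [r₁, r₂, r₃]
  rw [← sub_eq_zero] at h₁ h₂ h₃
  have := congrArg₂ (· + ·) h₁ (congrArg₂ (· + ·) h₂ h₃)
  simp only [add_zero] at this
  rw [← this]
  abel

theorem isCurvatureLike_riem (hcov : IsLeviCivita g cov) (p : M) :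
    IsCurvatureLike (V := TangentSpace I p) fun u v w z => g.inner p (riem cov p u v w) z where
  add u u' v w z := by rw [riem_add_left hcov, map_add, add_apply]
  smul a u v w z := by rw [riem_smul_left hcov, map_smul, _root_.smul_apply, smul_eq_mul]
  antisymm_left u v w z := by rw [riem_antisymm, map_neg, neg_apply]
  antisymm_right u v w z := by
    have h := riem_inner_self hcov u v (w + z)
    rw [riem_add_right hcov] at h
    simp only [map_add, add_apply, riem_inner_self hcov] at h
    linarith
  bianchi u v w z := by
    have h := congrArg (fun x => g.inner p x z) (riem_bianchi hcov u v w)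
    simpa using h

/-- The curvature tensor of a space of constant sectional curvature. -/
theorem inner_riem_of_const [T2Space M] (hcov : IsLeviCivita g cov) {c : ℝ}
    (hc : HasConstantSectionalCurvature g cov c) (u v w z : TangentSpace I p) :
    g.inner p (riem cov p u v w) z =
      c * (g.inner p v w * g.inner p u z - g.inner p u w * g.inner p v z) := by
  refine (isCurvatureLike_riem hcov p).eq_of_const (g.bilin p) (g.symm p) (g.nondegenerate p) c ?_
    u v w z
  intro u v huv
  obtain ⟨X, hX, hXu⟩ := exists_smoothField_eq (smoothNear_fieldExtend u)
  obtain ⟨Y, hY, hYv⟩ := exists_smoothField_eq (smoothNear_fieldExtend v)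
  have eX : X p = u := hXu.self_of_nhds.symm.trans (fieldExtend_self u)
  have eY : Y p = v := hYv.self_of_nhds.symm.trans (fieldExtend_self v)
  have hg : gram g p (X p) (Y p) ≠ 0 := by rw [eX, eY]; exact huv
  have h := hc X Y p (hX p) (hY p) hg
  rw [sectionalCurvature, div_eq_iff hg, curvature_eq_curvCov hcov (hX.near p) (hY.near p)
    (hY.near p), curvCov_eq_riem hcov (hY.near p), eX, eY] at h
  exact h

end curvature

/-! ### Curvature along a map -/

section curvatureAlong

variable [FiniteDimensional ℝ E] [FiniteDimensional ℝ E'] {g' : Metric I' M'}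
  {cov' : Connection I' M'} {f : M → M'} {p : M} {W : ∀ q : M, TangentSpace I' (f q)}
  {X Y : ∀ q : M, TangentSpace I q}

/-- The Ricci identity along `f`. The left side is tensorial in `W`, since the second derivatives of
a coefficient cancel against its derivative along [X,Y]. On restrictions it is the ambient
commutator, the first-order remainder vanishing by torsion-freeness along `f`. -/
theorem covAlong_comm (hcov' : IsLeviCivita g' cov') (hf : ContMDiff I I' ∞ f)
    (hX : SmoothNear X p) (hY : SmoothNear Y p) (hW : SmoothAlongNear I f W p) :
    covAlong I cov' f (fun q => covAlong I cov' f W q (Y q)) p (X p) -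
      covAlong I cov' f (fun q => covAlong I cov' f W q (X q)) p (Y p) -
        covAlong I cov' f W p (VectorField.mlieBracket I X Y p) =
      riem cov' (f p) (mfderiv I I' f p (X p)) (mfderiv I I' f p (Y p)) (W p) := by
  have hfd : ∀ q, MDifferentiableAt I I' f q := fun q => (hf q).mdifferentiableAt (by simp)
  obtain ⟨L, hL⟩ := exists_linear_curvCov hcov' (mfderiv I I' f p (X p)) (mfderiv I I' f p (Y p))
  have hL' : ∀ z, riem cov' (f p) (mfderiv I I' f p (X p)) (mfderiv I I' f p (Y p)) z = L z := by
    intro z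
    rw [riem, hL _ (smoothNear_fieldExtend z), fieldExtend_self]
  rw [hL']
  refine SmoothAlongNear.induction hf (fun W =>
    covAlong I cov' f (fun q => covAlong I cov' f W q (Y q)) p (X p) -
      covAlong I cov' f (fun q => covAlong I cov' f W q (X q)) p (Y p) -
        covAlong I cov' f W p (VectorField.mlieBracket I X Y p) = L (W p)) ?_ ?_ ?_ ?_ hW
  · intro W₁ W₂ _ he h
    have he' : ∀ U : ∀ q : M, TangentSpace I q, ∀ᶠ q in 𝓝 p,
        covAlong I cov' f W₁ q (U q) = covAlong I cov' f W₂ q (U q) := by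
      intro U
      filter_upwards [eventually_eventually_nhds.2 he] with q hq
      rw [covAlong_congr hq]
    rw [← covAlong_congr he, ← he.self_of_nhds, ← covAlong_congr (he' X),
      ← covAlong_congr (he' Y), h]
  · intro W₁ W₂ h₁ h₂ e₁ e₂
    have he : ∀ U : ∀ q : M, TangentSpace I q, ∀ᶠ q in 𝓝 p,
        covAlong I cov' f (fun q => W₁ q + W₂ q) q (U q) =
          covAlong I cov' f W₁ q (U q) + covAlong I cov' f W₂ q (U q) := by
      intro U
      filter_upwards [h₁, h₂] with q a b using covAlong_add a.diff b.diff _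
    rw [covAlong_congr (he X), covAlong_congr (he Y),
      covAlong_add (h₁.covAlong_apply hcov' hf hX).diff (h₂.covAlong_apply hcov' hf hX).diff,
      covAlong_add (h₁.covAlong_apply hcov' hf hY).diff (h₂.covAlong_apply hcov' hf hY).diff,
      covAlong_add h₁.diff h₂.diff, map_add, ← e₁, ← e₂]
    abel
  · intro φ W hφ h₁ e₁
    have he : ∀ U : ∀ q : M, TangentSpace I q, ∀ᶠ q in 𝓝 p,
        covAlong I cov' f (fun q => φ q • W q) q (U q) =
          φ q • covAlong I cov' f W q (U q) + mvfderiv I φ q (U q) • W q := by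
      intro U
      filter_upwards [hφ.eventually, h₁] with q a b using covAlong_smul a.diff b.diff _
    have hWX := h₁.covAlong_apply hcov' hf hX
    have hWY := h₁.covAlong_apply hcov' hf hY
    have hφX := hφ.mvfderiv_apply hX
    have hφY := hφ.mvfderiv_apply hY
    rw [covAlong_congr (he X), covAlong_congr (he Y),
      covAlong_add (hWX.smul hφ).diff (h₁.smul hφX).diff,
      covAlong_add (hWY.smul hφ).diff (h₁.smul hφY).diff,
      covAlong_smul hφ.diff h₁.diff, covAlong_smul hφ.diff hWX.diff,
      covAlong_smul hφ.diff hWY.diff, covAlong_smul hφX.diff h₁.diff,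
      covAlong_smul hφY.diff h₁.diff, map_smul, ← e₁, mvfderiv_mlieBracket hX hY hφ]
    module
  · intro Z hZ
    have he : ∀ U : ∀ q : M, TangentSpace I q, ∀ᶠ q in 𝓝 p,
        covAlong I cov' f (fun q => Z (f q)) q (U q) =
          cov' Z (f q) (mfderiv I I' f q (U q)) := by
      intro U
      filter_upwards [hf.continuous.continuousAt.eventually hZ] with q hq
      exact covAlong_comp (hfd q) hq.diff _
    rw [covAlong_congr (he X), covAlong_congr (he Y), covAlong_comp (hfd p) hZ.diff,
      covAlong_connection_apply hcov' hf hZ (hX.mfderiv_apply hf),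
      covAlong_connection_apply hcov' hf hZ (hY.mfderiv_apply hf),
      ← covAlong_torsion_free hcov' hf hX hY, map_sub, ← hL Z hZ, curvCov]
    abel

end curvatureAlong

/-! ### Conformal fields -/

section conformal

variable [FiniteDimensional ℝ E] [T2Space M] {g : Metric I M} {cov : Connection I M}
  {V : ∀ q : M, TangentSpace I q} {σ : M → ℝ} {p : M}

/-- Metric compatibility and torsion-freeness identify the Lie derivative of g with the
symmetrization of ∇V. -/
theorem IsConformalField.killing_eq (hV : IsConformalField g V σ) (hcov : IsLeviCivita g cov)
    (u w : TangentSpace I p) :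
    g.inner p (cov V p u) w + g.inner p u (cov V p w) = 2 * σ p * g.inner p u w := by
  obtain ⟨X, hX, hXu⟩ := exists_smoothField_eq (smoothNear_fieldExtend u)
  obtain ⟨Y, hY, hYw⟩ := exists_smoothField_eq (smoothNear_fieldExtend w)
  have eX : X p = u := hXu.self_of_nhds.symm.trans (fieldExtend_self u)
  have eY : Y p = w := hYw.self_of_nhds.symm.trans (fieldExtend_self w)
  have hVd := (hV.smooth.near p).diff
  have h := hV.lieDeriv_eq X Y p (hX p) (hY p)
  rw [lieDerivMetric, hcov.compatible X Y p _ (hX.near p).diff (hY.near p).diff,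
    ← hcov.torsion_free V X p hVd (hX.near p).diff, ← hcov.torsion_free V Y p hVd (hY.near p).diff, eX,
    eY] at h
  simp only [map_sub, sub_apply] at h
  linarith

/-- The derivative of the conformal Killing equation. -/
theorem IsConformalField.deriv_killing_eq (hV : IsConformalField g V σ)
    (hcov : IsLeviCivita g cov) (u v w : TangentSpace I p) :
    g.inner p (secondCov cov V p u v) w + g.inner p (secondCov cov V p u w) v =
      2 * mvfderiv I σ p u * g.inner p v w := by
  have hVn := hV.smooth.near p
  have hv := smoothNear_fieldExtend v
  have hw := smoothNear_fieldExtend w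
  have hVv := hVn.connection_apply_id hcov hv
  have hVw := hVn.connection_apply_id hcov hw
  have hσ : SmoothFunNear I σ p := Filter.Eventually.of_forall fun q => hV.smooth_factor q
  have hσ2 : SmoothFunNear I (fun q => 2 * σ q) p :=
    Filter.Eventually.of_forall fun q => contMDiffAt_const.mul (hV.smooth_factor q)
  have he : ∀ᶠ q in 𝓝 p, g.inner q (cov V q (fieldExtend v q)) (fieldExtend w q) +
      g.inner q (fieldExtend v q) (cov V q (fieldExtend w q)) =
        2 * σ q * g.inner q (fieldExtend v q) (fieldExtend w q) :=
    Filter.Eventually.of_forall fun q => hV.killing_eq hcov _ _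
  have h := mvfderiv_congr_apply he u
  rw [mvfderiv_fun_add_apply (hVv.inner hw) (hv.inner hVw),
    mvfderiv_fun_mul_apply hσ2 (hv.inner hw), mvfderiv_fun_mul_apply (SmoothFunNear.const 2) hσ,
    hcov.compatible _ _ p u hVv.diff hw.diff, hcov.compatible _ _ p u hv.diff hVw.diff,
    hcov.compatible _ _ p u hv.diff hw.diff, secondCov_eq hcov hVn hv, secondCov_eq hcov hVn hw]
    at h
  -- The Killing equation itself removes the terms in which the extensions of v and w are
  -- differentiated.
  have k₁ := hV.killing_eq hcov (cov (fieldExtend v) p u) w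
  have k₂ := hV.killing_eq hcov v (cov (fieldExtend w) p u)
  simp only [fieldExtend_self, map_add, add_apply, mvfderiv_const, zero_apply] at h
  rw [g.symm p v (secondCov cov V p u w)] at h
  linarith

/-- Put S(u,v,w) = g(∇²_{u,v}V, w). The differentiated Killing equation gives S(u,v,w) + S(u,w,v),
the curvature gives S(u,v,w) - S(v,u,w); as in Koszul's formula the three permutations of x, y, n
determine S(x,y,n). Orthogonality to n removes the derivatives of σ along x and y and all curvature
terms but c g(V,n) g(x,y). -/
theorem IsConformalField.inner_secondCov (hV : IsConformalField g V σ)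
    (hcov : IsLeviCivita g cov) {c : ℝ} (hc : HasConstantSectionalCurvature g cov c)
    {x y n : TangentSpace I p} (hx : g.inner p n x = 0) (hy : g.inner p n y = 0) :
    g.inner p (secondCov cov V p x y) n =
      -(mvfderiv I σ p n + c * g.inner p (V p) n) * g.inner p x y := by
  have hr : ∀ u v w : TangentSpace I p,
      g.inner p (secondCov cov V p u v) w - g.inner p (secondCov cov V p v u) w =
        c * (g.inner p v (V p) * g.inner p u w - g.inner p u (V p) * g.inner p v w) := by
    intro u v w
    rw [← inner_riem_of_const hcov hc, ← curvCov_eq_riem hcov (hV.smooth.near p), curvCov,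
      map_sub, sub_apply]
  have d := fun u v w => hV.deriv_killing_eq (cov := cov) hcov (p := p) u v w
  have r₁ := hr x y n
  have r₂ := hr x n y
  have r₃ := hr y n x
  have d₁ := d x y n
  have d₂ := d y x n
  have d₃ := d n x y
  rw [g.symm p x n, g.symm p y n, hx, hy] at r₁
  rw [hy] at r₂
  rw [hx, g.symm p y x] at r₃
  rw [g.symm p y n, hy] at d₁
  rw [g.symm p x n, hx] at d₂
  rw [g.symm p n (V p)] at r₂ r₃
  linarith

end conformal

/-! ### Smoothness of metrically dual fields -/

theorem Metric.ext_inner (g : Metric I M) {p : M} {v w : TangentSpace I p}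
    (h : ∀ x, g.inner p v x = g.inner p w x) : v = w := by
  refine sub_eq_zero.1 (g.nondegenerate p _ fun x => ?_)
  rw [map_sub, sub_apply, h, sub_self]

theorem smoothNear_sum {ι : Type*} (s : Finset ι) {φ : ι → M → ℝ}
    {X : ι → ∀ q : M, TangentSpace I q} {p : M} (hφ : ∀ i, SmoothFunNear I (φ i) p)
    (hX : ∀ i, SmoothNear (X i) p) : SmoothNear (fun q => ∑ i ∈ s, φ i q • X i q) p := by
  classical
  induction s using Finset.induction_on with
  | empty =>
    simp only [Finset.sum_empty]
    exact Filter.Eventually.of_forall fun q =>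
      (contMDiff_zeroSection ℝ (TangentSpace I : M → Type _)).contMDiffAt
  | insert i t hi ih =>
    simp only [Finset.sum_insert hi]
    exact SmoothNear.add (SmoothNear.smul (hφ i) (hX i)) ih

/-- A vector field is smooth if its scalar products with smooth vector fields are. -/
theorem smoothNear_of_inner [FiniteDimensional ℝ E] (g : Metric I M)
    {T : ∀ q : M, TangentSpace I q} {p : M}
    (h : ∀ X, SmoothNear X p → SmoothFunNear I (fun q => g.inner q (T q) (X q)) p) :
    SmoothNear T p := by
  have := FiniteDimensional.complete ℝ E
  let e := trivializationAt E (TangentSpace I : M → Type _) p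
  let b := Module.finBasis ℝ E
  let s := e.localFrame b
  have hbase : ∀ᶠ q in 𝓝 p, q ∈ e.baseSet :=
    e.open_baseSet.mem_nhds (FiberBundle.mem_baseSet_trivializationAt' p)
  have hs : ∀ i, SmoothNear (s i) p := by
    intro i
    filter_upwards [hbase] with q hq using contMDiffAt_localFrame_of_mem ∞ e b i hq
  let G : Fin (Module.finrank ℝ E) → Fin (Module.finrank ℝ E) → M → ℝ :=
    fun i j q => g.inner q (s i q) (s j q)
  let B : Fin (Module.finrank ℝ E) → M → ℝ := fun i q => g.inner q (T q) (s i q)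
  -- The Gram matrix of the frame, as an operator on the fixed space E. It is invertible by
  -- nondegeneracy and inversion is smooth, so solving A q · t = r q yields smooth coefficients for
  -- `T`.
  let A : M → E →L[ℝ] E := fun q => ∑ i, ∑ j, G i j q •
    (LinearMap.toContinuousLinearMap (b.coord j)).smulRight (b i)
  let r : M → E := fun q => ∑ i, B i q • b i
  have hA : ∀ᶠ q in 𝓝 p, ContMDiffAt I 𝓘(ℝ, E →L[ℝ] E) ∞ A q := by
    have : ∀ᶠ q in 𝓝 p, ∀ i j, ContMDiffAt I 𝓘(ℝ, ℝ) ∞ (G i j) q :=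
      Filter.eventually_all.2 fun i => Filter.eventually_all.2 fun j => (hs i).inner (hs j)
    filter_upwards [this] with q hq
    exact contMDiffAt_finsetSum fun i _ => contMDiffAt_finsetSum fun j _ =>
      (hq i j).smul contMDiffAt_const
  have hr : ∀ᶠ q in 𝓝 p, ContMDiffAt I 𝓘(ℝ, E) ∞ r q := by
    have : ∀ᶠ q in 𝓝 p, ∀ i, ContMDiffAt I 𝓘(ℝ, ℝ) ∞ (B i) q :=
      Filter.eventually_all.2 fun i => h _ (hs i)
    filter_upwards [this] with q hq
    exact contMDiffAt_finsetSum fun i _ => (hq i).smul contMDiffAt_const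
  have hAv : ∀ q v, A q v = ∑ i, (∑ j, G i j q * b.repr v j) • b i := by
    intro q v
    simp [A, Finset.sum_smul, smul_smul]
  have hAs : ∀ q (v : E), ∀ i,
      ∑ j, G i j q * b.repr v j = g.inner q (s i q) (∑ j, b.repr v j • s j q) := by
    intro q v i
    simp [G, map_sum, mul_comm]
  have hunit : ∀ q ∈ e.baseSet, IsUnit (A q) := by
    intro q hq
    let β := e.basisAt b hq
    have hβ : ∀ i, s i q = β i := fun i => e.localFrame_apply_of_mem_baseSet b hq
    have hinj : Function.Injective (A q).toLinearMap := by
      refine (injective_iff_map_eq_zero _).2 fun v hv => ?_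
      have h1 : ∑ i, (∑ j, G i j q * b.repr v j) • b i = 0 := (hAv q v).symm.trans hv
      have h2 := fun i => linearIndependent_iff'.1 b.linearIndependent Finset.univ _ h1 i
        (Finset.mem_univ i)
      have h3 : ∑ j, b.repr v j • s j q = 0 := by
        refine g.nondegenerate q _ fun w => ?_
        have h2' := fun i => (hAs q v i).symm.trans (h2 i)
        generalize (∑ j, b.repr v j • s j q) = y at h2' ⊢
        rw [g.symm, ← β.sum_repr w]
        simp only [map_sum, map_smul, sum_apply, _root_.smul_apply]
        refine Finset.sum_eq_zero fun i _ => ?_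
        rw [← hβ i, h2' i, smul_zero]
      simp only [hβ] at h3
      have h4 := fun i => linearIndependent_iff'.1 β.linearIndependent Finset.univ _ h3 i
        (Finset.mem_univ i)
      rw [← b.sum_repr v]
      exact Finset.sum_eq_zero fun i _ => by rw [h4 i, zero_smul]
    exact ContinuousLinearMap.isUnit_iff_bijective.2
      ⟨hinj, LinearMap.injective_iff_surjective.1 hinj⟩
  have hc : ∀ j, SmoothFunNear I (fun q => b.coord j (Ring.inverse (A q) (r q))) p := by
    intro j
    filter_upwards [hA, hr, hbase] with q h₁ h₂ hq
    obtain ⟨a, ha⟩ := hunit q hq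
    have hi : ContDiffAt ℝ ∞ Ring.inverse (A q) := ha ▸ contDiffAt_ringInverse ℝ a
    have h₃ : ContMDiffAt I 𝓘(ℝ, E) ∞ (fun q => Ring.inverse (A q) (r q)) q :=
      ContMDiffAt.clm_apply (hi.contMDiffAt.comp q h₁) h₂
    exact (LinearMap.toContinuousLinearMap (b.coord j)).contMDiff.contMDiffAt.comp q h₃
  refine SmoothAlongNear.congr (f := id) (smoothNear_sum Finset.univ hc hs) ?_
  filter_upwards [hbase] with q hq
  let β := e.basisAt b hq
  have hβ : ∀ i, s i q = β i := fun i => e.localFrame_apply_of_mem_baseSet b hq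
  have ht : A q (∑ j, β.repr (T q) j • b j) = r q := by
    rw [hAv]
    refine Finset.sum_congr rfl fun i _ => ?_
    rw [hAs]
    simp only [map_sum, map_smul, b.repr_self, hβ]
    have : ∀ j, (∑ k, β.repr (T q) k • Finsupp.single k (1 : ℝ)) j = β.repr (T q) j := by
      intro j
      simp
    simp only [this]
    simp only [← map_smul, ← map_sum, β.sum_repr]
    change _ = g.inner q (T q) (s i q) • b i
    rw [g.symm, hβ]
  have h5 : Ring.inverse (A q) (r q) = ∑ j, β.repr (T q) j • b j := by
    rw [← ht]
    exact DFunLike.congr_fun (Ring.inverse_mul_cancel _ (hunit q hq)) _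
  simp only [h5]
  simp only [map_sum, map_smul, Module.Basis.coord_apply, b.repr_self, hβ]
  rw [← β.sum_repr (T q)]
  refine Finset.sum_congr rfl fun i _ => ?_
  simp [Finsupp.single_apply]

/-! ### Hypersurfaces -/

section hypersurface

variable [FiniteDimensional ℝ E] [FiniteDimensional ℝ E'] {g : Metric I M} {g' : Metric I' M'}
  {cov : Connection I M} {cov' : Connection I' M'} {f : M → M'}
  {N W : ∀ q : M, TangentSpace I' (f q)} {p : M} {X Y Z : ∀ q : M, TangentSpace I q}

theorem inner_tangential (g : Metric I M) (g' : Metric I' M') (f : M → M') (p : M)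
    (w : TangentSpace I' (f p)) (x : TangentSpace I p) :
    g.inner p (tangential g g' f p w) x = g'.inner (f p) w (mfderiv I I' f p x) :=
  g.inner_sharp p _ x

theorem inner_grad (g : Metric I M) (φ : M → ℝ) (p : M) (x : TangentSpace I p) :
    g.inner p (grad g φ p) x = mvfderiv I φ p x :=
  g.inner_sharp p _ x

theorem SmoothFunNear.grad {φ : M → ℝ} (hφ : SmoothFunNear I φ p) : SmoothNear (grad g φ) p := by
  refine smoothNear_of_inner g fun X hX => ?_
  simp only [inner_grad]
  exact hφ.mvfderiv_apply hX

theorem SmoothAlongNear.tangential (hf : ContMDiff I I' ∞ f) (hW : SmoothAlongNear I f W p) :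
    SmoothNear (fun q => tangential g g' f q (W q)) p := by
  refine smoothNear_of_inner g fun X hX => ?_
  simp only [inner_tangential]
  exact hW.inner (hX.mfderiv_apply hf)

theorem inner_weingarten (g : Metric I M) (g' : Metric I' M') (cov' : Connection I' M')
    (f : M → M') (N : ∀ q : M, TangentSpace I' (f q)) (p : M) (v x : TangentSpace I p) :
    g.inner p (weingarten g g' cov' f N p v) x =
      -g'.inner (f p) (covAlong I cov' f N p v) (mfderiv I I' f p x) := by
  rw [weingarten, map_neg, neg_apply, inner_tangential]

theorem weingarten_sub (v w : TangentSpace I p) :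
    weingarten g g' cov' f N p (v - w) =
      weingarten g g' cov' f N p v - weingarten g g' cov' f N p w := by
  refine g.ext_inner fun x => ?_
  simp only [inner_weingarten, map_sub, sub_apply]
  ring

theorem SmoothNear.neg (hX : SmoothNear X p) : SmoothNear (fun q => -X q) p := by
  simpa using SmoothNear.smul (SmoothFunNear.const (-1)) hX

theorem SmoothNear.weingarten (hcov' : IsLeviCivita g' cov') (hf : ContMDiff I I' ∞ f)
    (hN : SmoothAlongNear I f N p) (hX : SmoothNear X p) :
    SmoothNear (fun q => weingarten g g' cov' f N q (X q)) p :=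
  ((hN.covAlong_apply hcov' hf hX).tangential hf).neg

/-- A vector is determined by its tangential and normal components. -/
theorem eq_add_normal (hf : IsIsometricImmersion g g' f) (hN : IsUnitNormal I g' f N)
    (hdim : Module.finrank ℝ E' = Module.finrank ℝ E + 1) (w : TangentSpace I' (f p)) :
    w = mfderiv I I' f p (tangential g g' f p w) +
      (g'.inner (f p) (N p) (N p) * g'.inner (f p) w (N p)) • N p := by
  have hε : g'.inner (f p) (N p) (N p) * g'.inner (f p) (N p) (N p) = 1 := by
    rcases hN.unit p with h | h <;> rw [h] <;> norm_num
  have hε0 : g'.inner (f p) (N p) (N p) ≠ 0 := fun h => by rw [h] at hε; norm_num at hε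
  have hNd : ∀ x, g'.inner (f p) (mfderiv I I' f p x) (N p) = 0 := fun x => by
    rw [g'.symm, hN.normal]
  have hker : ∀ (x : TangentSpace I p) (a : ℝ), mfderiv I I' f p x + a • N p = 0 →
      x = 0 ∧ a = 0 := by
    intro x a h
    refine ⟨g.nondegenerate p x fun y => ?_, ?_⟩
    · have h₁ := congrArg (fun u => g'.inner (f p) u (mfderiv I I' f p y)) h
      simpa only [map_add, map_smul, add_apply, _root_.smul_apply, hf.isometric, hN.normal,
        smul_zero, add_zero, map_zero, zero_apply] using h₁
    · have h₂ := congrArg (fun u => g'.inner (f p) u (N p)) h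
      simp only [map_add, map_smul, add_apply, _root_.smul_apply, hNd, smul_eq_mul, zero_add,
        map_zero, zero_apply] at h₂
      exact (mul_eq_zero.1 h₂).resolve_right hε0
  -- The map (x, a) ↦ df x + aN is injective, hence onto by the dimension count, and equality can be
  -- tested against its image.
  let L : E × ℝ →ₗ[ℝ] E' :=
    (mfderiv I I' f p).toLinearMap.coprod (LinearMap.toSpanSingleton ℝ E' (N p))
  have hinj : Function.Injective L := by
    refine (injective_iff_map_eq_zero L).2 fun z h => ?_
    obtain ⟨h₁, h₂⟩ := hker z.1 z.2 h
    exact Prod.ext h₁ h₂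
  have hsurj : Function.Surjective L :=
    (LinearMap.injective_iff_surjective_of_finrank_eq_finrank (by simp [hdim])).1 hinj
  refine g'.ext_inner fun z => ?_
  obtain ⟨x, a, rfl⟩ : ∃ (x : TangentSpace I p) (a : ℝ), z = mfderiv I I' f p x + a • N p := by
    obtain ⟨y, hy⟩ := hsurj z
    exact ⟨y.1, y.2, hy.symm⟩
  simp only [map_add, map_smul, add_apply, _root_.smul_apply, hf.isometric, inner_tangential,
    hN.normal, hNd, smul_eq_mul]
  linear_combination (-a * g'.inner (f p) w (N p)) * hε

/-- The derivative of the unit normal field is tangent. -/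
theorem inner_covAlong_normal_self (hcov' : IsLeviCivita g' cov')
    (hf : IsIsometricImmersion g g' f) (hN : IsUnitNormal I g' f N) (v : TangentSpace I p) :
    g'.inner (f p) (covAlong I cov' f N p v) (N p) = 0 := by
  have hNn := SmoothAlong.near hN.smooth p
  have hφ := SmoothAlongNear.inner (g' := g') hNn hNn
  have h₁ := mvfderiv_inner_along hcov' hf.smooth hNn hNn v
  -- The constant function differentiated is ε² = 1, since no local constancy of ε has been
  -- established.
  have he : ∀ᶠ q in 𝓝 p,
      g'.inner (f q) (N q) (N q) * g'.inner (f q) (N q) (N q) = 1 :=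
    Filter.Eventually.of_forall fun q => by rcases hN.unit q with h | h <;> rw [h] <;> norm_num
  have h₂ := mvfderiv_congr_apply he v
  rw [mvfderiv_fun_mul_apply hφ hφ, mvfderiv_const, zero_apply, h₁,
    g'.symm (f p) (N p) (covAlong I cov' f N p v)] at h₂
  rcases hN.unit p with h | h <;> rw [h] at h₂ <;> linarith

theorem covAlong_normal (hcov' : IsLeviCivita g' cov') (hf : IsIsometricImmersion g g' f)
    (hN : IsUnitNormal I g' f N) (hdim : Module.finrank ℝ E' = Module.finrank ℝ E + 1)
    (v : TangentSpace I p) :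
    covAlong I cov' f N p v = -mfderiv I I' f p (weingarten g g' cov' f N p v) := by
  have h := eq_add_normal hf hN hdim (covAlong I cov' f N p v)
  rw [inner_covAlong_normal_self hcov' hf hN, mul_zero, zero_smul, add_zero] at h
  rw [weingarten, map_neg, neg_neg]
  exact h

/-- The tangential part of the ambient derivative is the intrinsic one. -/
theorem inner_covAlong_tangent (hcov : IsLeviCivita g cov) (hcov' : IsLeviCivita g' cov')
    (hf : IsIsometricImmersion g g' f) (hX : SmoothNear X p) (hY : SmoothNear Y p)
    (hZ : SmoothNear Z p) :
    g'.inner (f p) (covAlong I cov' f (fun q => mfderiv I I' f q (Y q)) p (X p))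
      (mfderiv I I' f p (Z p)) = g.inner p (cov Y p (X p)) (Z p) := by
  have anti : ∀ {X Y Z : ∀ q : M, TangentSpace I q}, SmoothNear Y p → SmoothNear Z p →
      g'.inner (f p) (covAlong I cov' f (fun q => mfderiv I I' f q (Y q)) p (X p))
        (mfderiv I I' f p (Z p)) +
      g'.inner (f p) (covAlong I cov' f (fun q => mfderiv I I' f q (Z q)) p (X p))
        (mfderiv I I' f p (Y p)) =
      g.inner p (cov Y p (X p)) (Z p) + g.inner p (cov Z p (X p)) (Y p) := by
    intro X Y Z hY hZ
    rw [g.symm p (cov Z p (X p)), ← hcov.compatible Y Z p (X p) hY.diff hZ.diff,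
      g'.symm (f p) (covAlong I cov' f (fun q => mfderiv I I' f q (Z q)) p (X p)),
      ← mvfderiv_inner_along hcov' hf.smooth (hY.mfderiv_apply hf.smooth)
        (hZ.mfderiv_apply hf.smooth)]
    exact mvfderiv_congr_apply (Filter.Eventually.of_forall fun q => hf.isometric q _ _) _
  have sym : ∀ {X Y Z : ∀ q : M, TangentSpace I q}, SmoothNear X p → SmoothNear Y p →
      g'.inner (f p) (covAlong I cov' f (fun q => mfderiv I I' f q (Y q)) p (X p))
        (mfderiv I I' f p (Z p)) -
      g'.inner (f p) (covAlong I cov' f (fun q => mfderiv I I' f q (X q)) p (Y p))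
        (mfderiv I I' f p (Z p)) =
      g.inner p (cov Y p (X p)) (Z p) - g.inner p (cov X p (Y p)) (Z p) := by
    intro X Y Z hX hY
    rw [← sub_apply, ← map_sub, covAlong_torsion_free hcov' hf.smooth hX hY, hf.isometric,
      ← hcov.torsion_free X Y p hX.diff hY.diff, map_sub, sub_apply]
  -- The difference of the two sides is skew in (Y,Z) and symmetric in (X,Y), hence zero.
  linarith [anti (X := X) hY hZ, anti (X := Y) hX hZ, anti (X := Z) hX hY,
    sym (Z := Z) hX hY, sym (Z := Y) hX hZ, sym (Z := X) hY hZ]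

/-- Differentiate g'(N, df Y) = 0. This identifies the second fundamental form with the Weingarten
operator. -/
theorem inner_covAlong_tangent_normal (hcov' : IsLeviCivita g' cov')
    (hf : IsIsometricImmersion g g' f) (hN : IsUnitNormal I g' f N) (hY : SmoothNear Y p)
    (v : TangentSpace I p) :
    g'.inner (f p) (covAlong I cov' f (fun q => mfderiv I I' f q (Y q)) p v) (N p) =
      g.inner p (weingarten g g' cov' f N p v) (Y p) := by
  have hNn := SmoothAlong.near hN.smooth p
  have h := mvfderiv_inner_along hcov' hf.smooth hNn (hY.mfderiv_apply hf.smooth) v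
  have he : ∀ᶠ q in 𝓝 p, g'.inner (f q) (N q) (mfderiv I I' f q (Y q)) = 0 :=
    Filter.Eventually.of_forall fun q => hN.normal q _
  rw [mvfderiv_congr_apply he, mvfderiv_const, zero_apply, g'.symm (f p) (N p)] at h
  rw [inner_weingarten]
  linarith

/-- The second fundamental form is symmetric because D_v df W - D_w df U = df[U,W] has no normal
component. -/
theorem weingarten_symm (hcov' : IsLeviCivita g' cov') (hf : IsIsometricImmersion g g' f)
    (hN : IsUnitNormal I g' f N) (v w : TangentSpace I p) :
    g.inner p (weingarten g g' cov' f N p v) w = g.inner p (weingarten g g' cov' f N p w) v := by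
  have hv := smoothNear_fieldExtend v
  have hw := smoothNear_fieldExtend w
  have h := covAlong_torsion_free hcov' hf.smooth hv hw
  have h₁ := inner_covAlong_tangent_normal (g := g) hcov' hf hN hw v
  have h₂ := inner_covAlong_tangent_normal (g := g) hcov' hf hN hv w
  have h₃ := congrArg (fun u => g'.inner (f p) u (N p)) h
  simp only [fieldExtend_self, map_sub, sub_apply] at h₁ h₂ h₃
  rw [g'.symm (f p) (mfderiv I I' f p _), hN.normal] at h₃
  linarith

/-- The Gauss formula. -/
theorem covAlong_tangent (hcov : IsLeviCivita g cov) (hcov' : IsLeviCivita g' cov')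
    (hf : IsIsometricImmersion g g' f) (hN : IsUnitNormal I g' f N)
    (hdim : Module.finrank ℝ E' = Module.finrank ℝ E + 1) (hX : SmoothNear X p)
    (hY : SmoothNear Y p) :
    covAlong I cov' f (fun q => mfderiv I I' f q (Y q)) p (X p) =
      mfderiv I I' f p (cov Y p (X p)) + (g'.inner (f p) (N p) (N p) *
        g.inner p (weingarten g g' cov' f N p (X p)) (Y p)) • N p := by
  have h := eq_add_normal hf hN hdim
    (covAlong I cov' f (fun q => mfderiv I I' f q (Y q)) p (X p))
  rw [inner_covAlong_tangent_normal (g := g) hcov' hf hN hY] at h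
  have ht : tangential g g' f p (covAlong I cov' f (fun q => mfderiv I I' f q (Y q)) p (X p)) =
      cov Y p (X p) := by
    refine g.ext_inner fun z => ?_
    have hz := inner_covAlong_tangent hcov hcov' hf hX hY (smoothNear_fieldExtend z)
    rw [inner_tangential]
    simpa only [fieldExtend_self] using hz
  rwa [ht] at h

/-- The Codazzi equation in a space of constant curvature. -/
theorem covEndo_weingarten_symm [T2Space M'] (hcov : IsLeviCivita g cov)
    (hcov' : IsLeviCivita g' cov') (hf : IsIsometricImmersion g g' f)
    (hN : IsUnitNormal I g' f N) (hdim : Module.finrank ℝ E' = Module.finrank ℝ E + 1) {c : ℝ}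
    (hc : HasConstantSectionalCurvature g' cov' c) (hX : SmoothNear X p) (hY : SmoothNear Y p) :
    covEndo cov (weingarten g g' cov' f N) X Y p =
      covEndo cov (weingarten g g' cov' f N) Y X p := by
  have hNn := SmoothAlong.near hN.smooth p
  have hd : ∀ {X Y : ∀ q : M, TangentSpace I q}, SmoothNear X p → SmoothNear Y p → ∀ z,
      g'.inner (f p) (covAlong I cov' f (fun q => covAlong I cov' f N q (Y q)) p (X p))
        (mfderiv I I' f p z) =
      -g.inner p (cov (fun q => weingarten g g' cov' f N q (Y q)) p (X p)) z := by
    intro X Y hX hY z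
    have hAY : SmoothNear (fun q => weingarten g g' cov' f N q (Y q)) p :=
      hY.weingarten hcov' hf.smooth hNn
    have he : ∀ᶠ q in 𝓝 p, covAlong I cov' f N q (Y q) =
        (-1 : ℝ) • mfderiv I I' f q (weingarten g g' cov' f N q (Y q)) :=
      Filter.Eventually.of_forall fun q => by
        rw [covAlong_normal hcov' hf hN hdim, neg_one_smul]
    have h₁ := covAlong_smul (cov' := cov') (φ := fun _ => (-1 : ℝ)) mdifferentiableAt_const
      (hAY.mfderiv_apply hf.smooth).diff (X p)
    rw [covAlong_congr he, h₁, mvfderiv_const, zero_apply, zero_smul, add_zero]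
    have h₂ := inner_covAlong_tangent hcov hcov' hf hX hAY (smoothNear_fieldExtend z)
    rw [fieldExtend_self] at h₂
    rw [map_smul, _root_.smul_apply, h₂, neg_one_smul]
  refine g.ext_inner fun z => ?_
  -- The tangential part of the Ricci identity applied to N. Its curvature term is zero: in constant
  -- curvature, R'(df X, df Y)N involves only products of N with tangent vectors.
  have h := congrArg (fun u => g'.inner (f p) u (mfderiv I I' f p z))
    (covAlong_comm hcov' hf.smooth hX hY hNn)
  simp only [map_sub, sub_apply] at h
  rw [hd hX hY, hd hY hX, inner_riem_of_const hcov' hc, g'.symm (f p) _ (N p),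
    g'.symm (f p) _ (N p), hN.normal, hN.normal,
    ← hcov.torsion_free X Y p hX.diff hY.diff] at h
  have h₂ := inner_weingarten g g' cov' f N p (cov Y p (X p) - cov X p (Y p)) z
  rw [weingarten_sub] at h₂
  simp only [covEndo, map_sub, sub_apply] at h h₂ ⊢
  linarith

/-- The covariant derivative of the Weingarten operator is self-adjoint. -/
theorem inner_covEndo_weingarten (hcov : IsLeviCivita g cov) (hcov' : IsLeviCivita g' cov')
    (hf : IsIsometricImmersion g g' f) (hN : IsUnitNormal I g' f N) (hY : SmoothNear Y p)
    (hZ : SmoothNear Z p) :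
    g.inner p (covEndo cov (weingarten g g' cov' f N) X Y p) (Z p) =
      g.inner p (covEndo cov (weingarten g g' cov' f N) X Z p) (Y p) := by
  have hNn := SmoothAlong.near hN.smooth p
  have hAY : SmoothNear (fun q => weingarten g g' cov' f N q (Y q)) p :=
    hY.weingarten hcov' hf.smooth hNn
  have hAZ : SmoothNear (fun q => weingarten g g' cov' f N q (Z q)) p :=
    hZ.weingarten hcov' hf.smooth hNn
  have he : ∀ᶠ q in 𝓝 p, g.inner q (weingarten g g' cov' f N q (Y q)) (Z q) =
      g.inner q (weingarten g g' cov' f N q (Z q)) (Y q) :=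
    Filter.Eventually.of_forall fun q => weingarten_symm hcov' hf hN _ _
  have h := mvfderiv_congr_apply he (X p)
  rw [hcov.compatible _ _ p _ hAY.diff hZ.diff, hcov.compatible _ _ p _ hAZ.diff hY.diff,
    weingarten_symm hcov' hf hN (Y p), weingarten_symm hcov' hf hN (Z p)] at h
  simp only [covEndo, map_sub, sub_apply]
  linarith

/-! ### The Hessian of the angle function -/

/-- The computation itself, at a point and for fields smooth near it. Introducing `A` and `V`
through equations keeps them opaque to rewriting. -/
theorem hess_angle [T2Space M'] (hcov : IsLeviCivita g cov)
    (hcov' : IsLeviCivita g' cov') {c : ℝ} (hc : HasConstantSectionalCurvature g' cov' c)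
    (hf : IsIsometricImmersion g g' f) (hN : IsUnitNormal I g' f N)
    (hdim : Module.finrank ℝ E' = Module.finrank ℝ E + 1) {V' : ∀ y : M', TangentSpace I' y}
    {σ : M' → ℝ} (hV' : IsConformalField g' V' σ) (hX : SmoothNear X p) (hY : SmoothNear Y p)
    {A : ∀ q : M, TangentSpace I q → TangentSpace I q} (hA : A = weingarten g g' cov' f N)
    {V : ∀ q : M, TangentSpace I q} (hV : V = fun q => tangential g g' f q (V' (f q))) :
    hess g cov (angle g' f N V') X Y p =
      -(c * angle g' f N V' p + mvfderiv I' σ (f p) (N p)) * g.inner p (X p) (Y p)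
        + σ (f p) * g.inner p (A p (X p)) (Y p)
        + g'.inner (f p) (N p) (N p) * angle g' f N V' p * g.inner p (A p (A p (X p))) (Y p)
        - g.inner p (covEndo cov A V X p) (Y p)
        - g.inner p (A p (cov V p (X p))) (Y p)
        - g.inner p (A p (cov V p (Y p))) (X p) := by
  have hfd : ∀ q, MDifferentiableAt I I' f q := fun q => (hf.smooth q).mdifferentiableAt (by simp)
  have hε : g'.inner (f p) (N p) (N p) * g'.inner (f p) (N p) (N p) = 1 := by
    rcases hN.unit p with h | h <;> rw [h] <;> norm_num
  have hV'n := fun y => hV'.smooth.near y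
  have hVf : ∀ q, SmoothAlongNear I f (fun q => V' (f q)) q := fun q =>
    (hV'n (f q)).comp hf.smooth
  have hNn : ∀ q, SmoothAlongNear I f N q := fun q => SmoothAlong.near hN.smooth q
  have hVn : ∀ q, SmoothNear V q := fun q => by
    rw [hV]; exact (hVf q).tangential hf.smooth
  have hAn : ∀ {U : ∀ q : M, TangentSpace I q}, SmoothNear U p →
      SmoothNear (fun q => A q (U q)) p := fun {U} hU => by
    rw [hA]; exact hU.weingarten hcov' hf.smooth (hNn p)
  have hVi : ∀ q x, g.inner q (V q) x = g'.inner (f q) (V' (f q)) (mfderiv I I' f q x) :=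
    fun q x => by rw [hV]; exact inner_tangential g g' f q _ x
  have hAs : ∀ v w : TangentSpace I p, g.inner p (A p v) w = g.inner p (A p w) v :=
    fun v w => by rw [hA]; exact weingarten_symm hcov' hf hN v w
  have hDN : ∀ q v, covAlong I cov' f N q v = -mfderiv I I' f q (A q v) :=
    fun q v => by rw [hA]; exact covAlong_normal hcov' hf hN hdim v
  have hDV : ∀ q (v : TangentSpace I q), covAlong I cov' f (fun q => V' (f q)) q v =
      cov' V' (f q) (mfderiv I I' f q v) := fun q v => covAlong_comp (hfd q) (hV'n _).diff v
  have gauss : ∀ {U W : ∀ q : M, TangentSpace I q}, SmoothNear U p → SmoothNear W p →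
      covAlong I cov' f (fun q => mfderiv I I' f q (W q)) p (U p) =
        mfderiv I I' f p (cov W p (U p)) +
          (g'.inner (f p) (N p) (N p) * g.inner p (A p (U p)) (W p)) • N p := by
    intro U W hU hW
    rw [hA]; exact covAlong_tangent hcov hcov' hf hN hdim hU hW
  have hCn : SmoothFunNear I (angle g' f N V') p := (hVf p).inner (hNn p)
  -- the first derivative of the angle function
  have hC : ∀ q (v : TangentSpace I q), mvfderiv I (angle g' f N V') q v =
      g'.inner (f q) (cov' V' (f q) (mfderiv I I' f q v)) (N q) + -1 * g.inner q (V q) (A q v) := by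
    intro q v
    have h := mvfderiv_inner_along hcov' hf.smooth (hVf q) (hNn q) v
    rw [hDV, hDN, map_neg, ← hVi] at h
    exact h.trans (by ring)
  have hdY := hY.mfderiv_apply hf.smooth
  have hKY : SmoothAlongNear I f (fun q => cov' V' (f q) (mfderiv I I' f q (Y q))) p :=
    (hV'n (f p)).connection_apply hcov' hf.smooth hdY
  have hAY := hAn hY
  -- the second derivative of the angle function
  have hgrad := hCn.grad (g := g)
  have h₁ : hess g cov (angle g' f N V') X Y p =
      mvfderiv I (fun q => mvfderiv I (angle g' f N V') q (Y q)) p (X p) -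
        mvfderiv I (angle g' f N V') p (cov Y p (X p)) := by
    have h := hcov.compatible _ Y p (X p) hgrad.diff hY.diff
    simp only [inner_grad] at h
    rw [hess]
    linarith
  have hneg : SmoothFunNear I (fun q => -1 * g.inner q (V q) (A q (Y q))) p :=
    Filter.Eventually.mono ((hVn p).inner hAY) fun q hq => contMDiffAt_const.mul hq
  have h₂ : mvfderiv I (fun q => mvfderiv I (angle g' f N V') q (Y q)) p (X p) =
      g'.inner (f p) (secondCov cov' V' (f p) (mfderiv I I' f p (X p)) (mfderiv I I' f p (Y p)))
          (N p) +
        g'.inner (f p) (cov' V' (f p)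
          (covAlong I cov' f (fun q => mfderiv I I' f q (Y q)) p (X p))) (N p) -
        g'.inner (f p) (cov' V' (f p) (mfderiv I I' f p (Y p))) (mfderiv I I' f p (A p (X p))) -
        (g.inner p (cov V p (X p)) (A p (Y p)) +
          g.inner p (V p) (cov (fun q => A q (Y q)) p (X p))) := by
    rw [mvfderiv_congr_apply (Filter.Eventually.of_forall fun q => hC q (Y q)),
      mvfderiv_fun_add_apply (hKY.inner (hNn p)) hneg,
      mvfderiv_fun_mul_apply (SmoothFunNear.const (-1)) ((hVn p).inner hAY),
      mvfderiv_inner_along hcov' hf.smooth hKY (hNn p),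
      covAlong_connection_apply hcov' hf.smooth (hV'n _) hdY,
      hcov.compatible V _ p _ (hVn p).diff hAY.diff, hDN]
    simp only [map_add, map_neg, add_apply, mvfderiv_const, zero_apply]
    ring
  have h₃ : g'.inner (f p) (secondCov cov' V' (f p) (mfderiv I I' f p (X p))
      (mfderiv I I' f p (Y p))) (N p) =
      -(mvfderiv I' σ (f p) (N p) + c * angle g' f N V' p) * g.inner p (X p) (Y p) := by
    rw [hV'.inner_secondCov hcov' hc (hN.normal p _) (hN.normal p _), hf.isometric]
    rfl
  have h₄ : g'.inner (f p) (cov' V' (f p) (N p)) (N p) =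
      σ (f p) * g'.inner (f p) (N p) (N p) := by
    have h := hV'.killing_eq hcov' (N p) (N p)
    rw [g'.symm (f p) (N p) (cov' V' (f p) (N p))] at h
    linarith
  -- Differentiate g'(V', df AX) = g(V, AX) along Y on both sides. The normal part of the Gauss
  -- formula for D_Y(df AX), paired with V', produces the term in εC.
  have h₅ : g'.inner (f p) (cov' V' (f p) (mfderiv I I' f p (Y p)))
      (mfderiv I I' f p (A p (X p))) = g.inner p (cov V p (Y p)) (A p (X p)) -
        g'.inner (f p) (N p) (N p) * angle g' f N V' p * g.inner p (A p (Y p)) (A p (X p)) := by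
    have hAX := hAn hX
    have h := mvfderiv_inner_along hcov' hf.smooth (hVf p) (hAX.mfderiv_apply hf.smooth) (Y p)
    have he : ∀ᶠ q in 𝓝 p, g'.inner (f q) (V' (f q)) (mfderiv I I' f q (A q (X q))) =
        g.inner q (V q) (A q (X q)) := Filter.Eventually.of_forall fun q => (hVi q _).symm
    rw [mvfderiv_congr_apply he, hcov.compatible V _ p _ (hVn p).diff hAX.diff, hDV,
      gauss hY hAX, map_add, map_smul, ← hVi, smul_eq_mul,
      show g'.inner (f p) (V' (f p)) (N p) = angle g' f N V' p from rfl] at h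
    linarith
  -- Codazzi exchanges V and X in (∇_V A)X, and self-adjointness of ∇_X A then exchanges V and Y.
  have h₆ : g.inner p (covEndo cov A V X p) (Y p) =
      g.inner p (V p) (cov (fun q => A q (Y q)) p (X p)) -
        g.inner p (V p) (A p (cov Y p (X p))) := by
    have e : g.inner p (covEndo cov A V X p) (Y p) = g.inner p (covEndo cov A X Y p) (V p) := by
      rw [hA, covEndo_weingarten_symm hcov hcov' hf hN hdim hc (hVn p) hX,
        inner_covEndo_weingarten hcov hcov' hf hN (hVn p) hY]
    rw [e, g.symm, covEndo, map_sub]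
  rw [h₁, h₂, h₃, hC, gauss hX hY, h₅, h₆, hAs (A p (X p)) (Y p), hAs (cov V p (X p)) (Y p),
    hAs (cov V p (Y p)) (X p), g.symm p (cov V p (X p)), g.symm p (cov V p (Y p))]
  simp only [map_add, map_smul, add_apply, _root_.smul_apply, smul_eq_mul, h₄]
  -- The normal part of D_X df Y contributes ε · σε · g(AX,Y); ε² = 1 is needed only here.
  linear_combination (σ (f p) * g.inner p (A p (X p)) (Y p)) * hε

end hypersurface

end SemiRiem

end

theorem lemma4 {n : ℕ}
    {M : Type*} [TopologicalSpace M] [ChartedSpace (EuclideanSpace ℝ (Fin n)) M]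
    [IsManifold (𝓡 n) ∞ M] [T2Space M] [SecondCountableTopology M]
    {M' : Type*} [TopologicalSpace M'] [ChartedSpace (EuclideanSpace ℝ (Fin (n + 1))) M']
    [IsManifold (𝓡 (n + 1)) ∞ M'] [T2Space M'] [SecondCountableTopology M']
    -- the metrics and their Levi-Civita connections
    (g : SemiRiem.Metric (𝓡 n) M) (cov : SemiRiem.Connection (𝓡 n) M)
    (hcov : SemiRiem.IsLeviCivita g cov)
    (g' : SemiRiem.Metric (𝓡 (n + 1)) M') (cov' : SemiRiem.Connection (𝓡 (n + 1)) M')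
    (hcov' : SemiRiem.IsLeviCivita g' cov')
    -- the ambient manifold has constant sectional curvature
    (c : ℝ) (hc : SemiRiem.HasConstantSectionalCurvature g' cov' c)
    -- the hypersurface and its unit normal field
    (f : M → M') (hf : SemiRiem.IsIsometricImmersion g g' f)
    (N : ∀ p : M, TangentSpace (𝓡 (n + 1)) (f p)) (hN : SemiRiem.IsUnitNormal (𝓡 n) g' f N)
    -- the ambient conformal field and its conformal factor
    (V' : ∀ p : M', TangentSpace (𝓡 (n + 1)) p) (σ : M' → ℝ)
    (hV' : SemiRiem.IsConformalField g' V' σ)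
    (X Y : ∀ p : M, TangentSpace (𝓡 n) p)
    (hX : SemiRiem.SmoothField X) (hY : SemiRiem.SmoothField Y) (p : M) :
    let ε : ℝ := g'.inner (f p) (N p) (N p)
    let C : M → ℝ := SemiRiem.angle g' f N V'
    let A : ∀ p : M, TangentSpace (𝓡 n) p → TangentSpace (𝓡 n) p :=
      SemiRiem.weingarten g g' cov' f N
    let V : ∀ p : M, TangentSpace (𝓡 n) p := fun q => SemiRiem.tangential g g' f q (V' (f q))
    SemiRiem.hess g cov C X Y p =
      -(c * C p + mvfderiv (𝓡 (n + 1)) σ (f p) (N p)) * g.inner p (X p) (Y p)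
        + σ (f p) * g.inner p (A p (X p)) (Y p)
        + ε * C p * g.inner p (A p (A p (X p))) (Y p)
        - g.inner p (SemiRiem.covEndo cov A V X p) (Y p)
        - g.inner p (A p (cov V p (X p))) (Y p)
        - g.inner p (A p (cov V p (Y p))) (X p) := by
  intro ε C A V
  exact SemiRiem.hess_angle hcov hcov' hc hf hN (by simp) hV' (hX.near p) (hY.near p) rfl rfl
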